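/- Let $G$ be a finite directed graph with vertex set $V(G)$ and edge set $E(G)$; loops and multiple edges are allowed. For a vertex $v$, let $x_1,\dots,x_m$ be the edges with initial vertex $v$ and $y_1,\dots,y_n$ the edges with terminal vertex $v$, regarded as variables of $\mathbb{Z}[E(G)]$, and let $e_l$ denote the $l$-th elementary symmetric polynomial. Let $\tilde I(G)\subset\mathbb{Z}[E(G)]$ be the homogeneous ideal generated, over all vertices $v$, by $e_1(x_1,\dots,x_m)-e_1(y_1,\dots,y_n)$, the $e_l(x_1,\dots,x_m)$ with $2\le l\le m$, and the $e_l(y_1,\dots,y_n)$ with $2\le l\le n$. Let $$\tilde P(G)=\{p\in\mathbb{CP}^{|E(G)|-1} : f(p)=0 \text{ for all } f\in\tilde I(G)\}.$$ A directed cycle is a closed directed path without repeated vertices, considered up to circular permutation (a loop is a directed cycle). Two directed cycles are disjoint if they have no common vertex. Let $\tilde\alpha(G)$ be the maximal number of pairwise disjoint directed cycles in $G$. A collection of pairwise disjoint directed cycles is strongly maximal if it is not properly contained in another such collection, and $\tilde\gamma_n(G)$ is the number of strongly maximal collections with exactly $n$ cycles. Then: 1. $\tilde P(G)$ is a union of finitely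 many linear subspaces of $\mathbb{CP}^{|E(G)|-1}$. 2. $\dim\tilde P(G)=\tilde\alpha(G)-1$, where $\dim\emptyset=-1$. 3. If $\tilde\alpha(G)\ge 1$, that is, if $G$ contains a directed cycle, then $\deg\tilde P(G)=\tilde\gamma_{\tilde\alpha(G)}(G)$. 4. For every $n\ge 1$, $\tilde\gamma_n(G)$ is equal to the number of irreducible components of $\tilde P(G)$ of dimension $n-1$. Here dimension and irreducible components refer to the Zariski topology. The degree of a nonempty projective algebraic set of dimension $r$ is $r!$ times the leading coefficient of its Hilbert polynomial; equivalently, it is the sum of the degrees of its $r$-dimensional irreducible components. -/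

import Mathlib

open scoped LinearAlgebra.Projectivization

/-! ### Complex projective space with homogeneous coordinates indexed by `E` -/

/-- The projective space of dimension `|E| - 1` over `ℂ`, with homogeneous coordinates indexed by
`E`. -/
abbrev CProj (E : Type*) : Type _ := ℙ ℂ (E → ℂ)

namespace CProj

variable {E : Type*}

/-- The polynomial `f` (with coefficients in `R = ℤ` or `R = ℂ`) vanishes at the point `p`: it is
zero at every vector of homogeneous coordinates of `p`. -/
def Vanishes {R : Type*} [CommRing R] [Algebra R ℂ] (f : MvPolynomial E R) (p : CProj E) : Prop :=
  ∀ (v : E → ℂ) (hv : v ≠ 0), Projectivization.mk ℂ v hv = p → MvPolynomial.aeval v f = 0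

/-- The set of common zeros of a set of polynomials. -/
def zeroLocus {R : Type*} [CommRing R] [Algebra R ℂ] (F : Set (MvPolynomial E R)) :
    Set (CProj E) :=
  {p | ∀ f ∈ F, Vanishes f p}

/-- Projective algebraic sets: the common zeros of a set of homogeneous complex polynomials. -/
def algebraicSets (E : Type*) : Set (Set (CProj E)) :=
  {Z | ∃ F : Set (MvPolynomial E ℂ), (∀ f ∈ F, ∃ d : ℕ, f.IsHomogeneous d) ∧ Z = zeroLocus F}

theorem vanishes_mul {f g : MvPolynomial E ℂ} {m n : ℕ} (hf : f.IsHomogeneous m)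
    (hg : g.IsHomogeneous n) (p : CProj E) :
    Vanishes (f * g) p ↔ Vanishes f p ∨ Vanishes g p := by
  have scale : ∀ {h : MvPolynomial E ℂ} {d : ℕ}, h.IsHomogeneous d →
      MvPolynomial.aeval p.rep h = 0 → Vanishes h p := by
    intro h d hh h0 v hv hvp
    rw [← p.mk_rep, Projectivization.mk_eq_mk_iff'] at hvp
    obtain ⟨a, rfl⟩ := hvp
    have key : MvPolynomial.aeval (a • p.rep) h = a ^ d * MvPolynomial.aeval p.rep h := by
      rw [MvPolynomial.aeval_def, MvPolynomial.aeval_def, MvPolynomial.eval₂_eq,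
        MvPolynomial.eval₂_eq, Finset.mul_sum]
      refine Finset.sum_congr rfl fun m hm => ?_
      have hd : ∑ i ∈ m.support, m i = d := by
        simpa [Finsupp.weight_apply, Finsupp.sum] using hh (MvPolynomial.mem_support_iff.1 hm)
      simp only [Pi.smul_apply, smul_eq_mul, mul_pow, Finset.prod_mul_distrib,
        Finset.prod_pow_eq_pow_sum, hd]
      ring
    rw [key, h0, mul_zero]
  constructor
  · intro h
    have h1 := h p.rep p.rep_nonzero p.mk_rep
    rw [map_mul, mul_eq_zero] at h1
    exact h1.imp (scale hf) (scale hg)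
  · rintro (h | h) v hv hvp
    · rw [map_mul, h v hv hvp, zero_mul]
    · rw [map_mul, h v hv hvp, mul_zero]

/-- The Zariski topology: the closed sets are the projective algebraic sets. -/
instance zariskiTopology : TopologicalSpace (CProj E) :=
  TopologicalSpace.ofClosed (algebraicSets E)
    (by
      refine ⟨{1}, ?_, ?_⟩
      · rintro f rfl
        exact ⟨0, MvPolynomial.isHomogeneous_one E ℂ⟩
      · ext p
        simp only [Set.mem_empty_iff_false, zeroLocus, Set.mem_singleton_iff, forall_eq,
          Set.mem_ofPred_eq, false_iff]
        intro h
        simpa using h p.rep p.rep_nonzero p.mk_rep)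
    (by
      intro A hA
      choose! F hF hAF using fun Z (h : Z ∈ A) => hA h
      refine ⟨⋃ Z ∈ A, F Z, ?_, ?_⟩
      · intro f hf
        simp only [Set.mem_iUnion] at hf
        obtain ⟨Z, hZ, hfZ⟩ := hf
        exact hF Z hZ f hfZ
      · ext p
        simp only [Set.mem_sInter, zeroLocus, Set.mem_iUnion, Set.mem_ofPred_eq]
        constructor
        · rintro h f ⟨Z, hZ, hfZ⟩
          have := h Z hZ
          rw [hAF Z hZ] at this
          exact this f hfZ
        · intro h Z hZ
          rw [hAF Z hZ]
          exact fun f hf => h f ⟨Z, hZ, hf⟩)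
    (by
      rintro _ ⟨F, hF, rfl⟩ _ ⟨F', hF', rfl⟩
      refine ⟨{h | ∃ f ∈ F, ∃ g ∈ F', h = f * g}, ?_, ?_⟩
      · rintro _ ⟨f, hf, g, hg, rfl⟩
        obtain ⟨m, hm⟩ := hF f hf
        obtain ⟨n, hn⟩ := hF' g hg
        exact ⟨m + n, hm.mul hn⟩
      · ext p
        constructor
        · rintro (h | h) _ ⟨f, hf, g, hg, rfl⟩ v hv hvp
          · rw [map_mul, h f hf v hv hvp, zero_mul]
          · rw [map_mul, h g hg v hv hvp, mul_zero]
        · intro h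
          by_contra hne
          simp only [Set.mem_union, not_or, zeroLocus, Set.mem_ofPred_eq, not_forall] at hne
          obtain ⟨⟨f, hf, hfp⟩, ⟨g, hg, hgp⟩⟩ := hne
          obtain ⟨m, hm⟩ := hF f hf
          obtain ⟨n, hn⟩ := hF' g hg
          rcases (vanishes_mul hm hn p).1 (h _ ⟨f, hf, g, hg, rfl⟩) with h1 | h1
          · exact hfp h1
          · exact hgp h1)

/-- `HasDim Z d`: the topological space `Z` has dimension `d`, where the dimension is the maximal
length of a chain of irreducible closed subsets, and the empty space has dimension `-1`. -/
def HasDim (Z : Type*) [TopologicalSpace Z] (d : ℤ) : Prop :=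
  (IsEmpty Z ∧ d = -1) ∨ ∃ r : ℕ, d = r ∧ topologicalKrullDim Z = r

/-- The homogeneous vanishing ideal of a set `X` of points of projective space. -/
def vanishingIdeal (X : Set (CProj E)) : Ideal (MvPolynomial E ℂ) where
  carrier := {f | ∀ p ∈ X, Vanishes f p}
  add_mem' := by
    intro f g hf hg p hp v hv hvp
    rw [map_add, hf p hp v hv hvp, hg p hp v hv hvp, add_zero]
  zero_mem' := by
    intro p _ v _ _
    exact map_zero _
  smul_mem' := by
    intro c f hf p hp v hv hvp
    rw [smul_eq_mul, map_mul, hf p hp v hv hvp, mul_zero]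

/-- The Hilbert function of `X`: the dimension of the degree `t` part of the homogeneous coordinate
ring of `X`, that is, of the forms of degree `t` modulo those which vanish on `X`. -/
noncomputable def hilbertFunction (X : Set (CProj E)) (t : ℕ) : ℕ :=
  Module.finrank ℂ (MvPolynomial.homogeneousSubmodule E ℂ t ⧸
    ((vanishingIdeal X).restrictScalars ℂ).submoduleOf (MvPolynomial.homogeneousSubmodule E ℂ t))

/-- `HasDegree X m`: the projective algebraic set `X` has a Hilbert polynomial `P`, and the degree
of `X`, which is `r!` times the leading coefficient of `P` for `r` the degree of `P`, is `m`. -/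
def HasDegree (X : Set (CProj E)) (m : ℕ) : Prop :=
  ∃ P : Polynomial ℚ,
    (∀ᶠ t : ℕ in Filter.atTop, (hilbertFunction X t : ℚ) = P.eval (t : ℚ)) ∧
      (P.natDegree.factorial : ℚ) * P.leadingCoeff = m

end CProj

/-! ### Directed graphs -/

/-- A directed graph with vertices `V` and edges `E`; loops and multiple edges are allowed. -/
structure DirectedGraph (V E : Type*) where
  /-- The initial vertex of an edge. -/
  init : E → V
  /-- The terminal vertex of an edge. -/
  term : E → V

namespace DirectedGraph

variable {V E : Type*} (G : DirectedGraph V E)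

/-- A directed cycle `v₀, x₀, v₁, x₁, …, vₙ, xₙ, v₀`, given by the cyclic sequence (a list up to
rotation) of its edges `x₀, …, xₙ`: the sequence is not empty, the terminal vertex of each edge is
the initial vertex of the next one, and the vertices `vᵢ = init xᵢ` are pairwise distinct. -/
def IsDirectedCycle (c : Cycle E) : Prop :=
  c ≠ Cycle.nil ∧ c.Chain (fun x y => G.term x = G.init y) ∧ (c.map G.init).Nodup

/-- The type of directed cycles of `G`. -/
def DirectedCycle : Type _ := {c : Cycle E // G.IsDirectedCycle c}

/-- The set of vertices of a directed cycle. -/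
def DirectedCycle.vertices {G : DirectedGraph V E} (C : G.DirectedCycle) : Set V :=
  {v | v ∈ C.1.map G.init}

instance finiteDirectedCycle [Finite E] : Finite G.DirectedCycle := by
  classical
  have := Fintype.ofFinite E
  refine Finite.of_injective
    (β := {s : Cycle E // s.Nodup}) (fun C => ⟨C.1, ?_⟩) ?_
  · obtain ⟨c, _, _, h⟩ := C
    induction c using Quotient.inductionOn with
    | h l => exact List.Nodup.of_map _ h
  · intro C D h
    exact Subtype.ext (congrArg (fun s : {s : Cycle E // s.Nodup} => s.1) h)

/-- A collection of pairwise (vertex-)disjoint directed cycles. -/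
def PairwiseDisjointCycles (𝒞 : Finset G.DirectedCycle) : Prop :=
  (𝒞 : Set G.DirectedCycle).Pairwise fun C D => Disjoint C.vertices D.vertices

/-- A strongly maximal collection: one that is maximal under inclusion among the collections of
pairwise disjoint directed cycles. -/
def StronglyMaximal (𝒞 : Finset G.DirectedCycle) : Prop :=
  Maximal G.PairwiseDisjointCycles 𝒞

/-- The strong cycle packing number: the maximal number of pairwise disjoint directed cycles. -/
noncomputable def strongPackingNumber : ℕ :=
  sSup {k | ∃ 𝒞 : Finset G.DirectedCycle, G.PairwiseDisjointCycles 𝒞 ∧ 𝒞.card = k}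

/-- The strong cycle spectrum: the number of strongly maximal collections of exactly `n` pairwise
disjoint directed cycles. -/
noncomputable def strongSpectrum (n : ℕ) : ℕ :=
  {𝒞 : Finset G.DirectedCycle | G.StronglyMaximal 𝒞 ∧ 𝒞.card = n}.ncard

section Incidence

variable [Fintype E]

open Classical in
/-- The edges which have `v` as their initial vertex. -/
noncomputable def outEdges (v : V) : Finset E := Finset.univ.filter fun x => G.init x = v

open Classical in
/-- The edges which have `v` as their terminal vertex. -/
noncomputable def inEdges (v : V) : Finset E := Finset.univ.filter fun x => G.term x = v

/-- The `l`-th elementary symmetric polynomial in the variables that belong to the edges in `s`. -/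
noncomputable def elemSymm (s : Finset E) (l : ℕ) : MvPolynomial E ℤ :=
  ∑ t ∈ s.powersetCard l, ∏ x ∈ t, MvPolynomial.X x

/-- The strong incidence relations at the vertex `v`. -/
def strongRelationsAt (v : V) : Set (MvPolynomial E ℤ) :=
  {elemSymm (G.outEdges v) 1 - elemSymm (G.inEdges v) 1} ∪
    {f | ∃ l, 2 ≤ l ∧ l ≤ (G.outEdges v).card ∧ f = elemSymm (G.outEdges v) l} ∪
    {f | ∃ l, 2 ≤ l ∧ l ≤ (G.inEdges v).card ∧ f = elemSymm (G.inEdges v) l}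

/-- The strong incidence ideal, generated by all the strong incidence relations. -/
noncomputable def strongIncidenceIdeal : Ideal (MvPolynomial E ℤ) :=
  Ideal.span (⋃ v : V, G.strongRelationsAt v)

/-- The strong incidence set: the points of complex projective space at which all the polynomials
of the strong incidence ideal vanish. -/
def strongIncidenceSet : Set (CProj E) :=
  CProj.zeroLocus (G.strongIncidenceIdeal : Set (MvPolynomial E ℤ))

end Incidence

end DirectedGraph

/-! Fix a vector `v` of edge weights. If exactly `l ≥ 2` of the edges leaving a vertex have nonzero
weight, then the `l`-th elementary symmetric polynomial of these edges reduces at `v` to the product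
of those weights, which is not zero. Hence the relations of degree at least 2 say that at most one
edge of the support of `v` leaves, and at most one enters, each vertex. The linear relations say
that inflow equals outflow. Together they force the support to be a union of disjoint directed
cycles with `v` constant on each, and every such `v` is a solution
(`forall_mem_strongIncidenceIdeal_iff_exists`).

So the affine cone is the union, over all packings (collections of disjoint cycles), of the
injective images of the spaces of weights on their cycles. Inclusion of these subspaces is inclusion
of packings (`range_packingMap_le_iff`). The finitely many projectivized subspaces are closed, and
irreducible when the packing is nonempty. The irreducible components are therefore the subspaces of
the nonempty strongly maximal packings, a packing of `n` cycles giving a projective space of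
dimension `n - 1`. This settles the claims on linearity, dimension and components, once projective
space is shown to have the expected Krull dimension (`topologicalKrullDim_eq`).

For the degree, write a form of degree `t` in the cycle weights. It vanishes on the incidence set
iff no monomial supported on a packing survives, so the Hilbert function is the rank of a
coefficient map. With `r + 1` the largest size of a packing and `γ` the number of packings of that
size, counting monomials bounds this rank above, and explicit edge monomials bound it below, both by
quantities asymptotic to `γ * t ^ r / r!`. A Hilbert polynomial exists by a separate count of
standard monomials, and its degree and leading coefficient are read off from this limit. -/

namespace CProj

open MvPolynomial

/-! ### Vanishing at a projective point, and the Zariski topology. -/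

section Vanishing

variable {E : Type*}

/-- Restriction of a polynomial to the line spanned by `v`. -/
noncomputable def scaleHom (v : E → ℂ) : MvPolynomial E ℂ →ₐ[ℂ] Polynomial ℂ :=
  aeval fun e => Polynomial.C (v e) * Polynomial.X

theorem eval_scaleHom (v : E → ℂ) (f : MvPolynomial E ℂ) (a : ℂ) :
    (scaleHom v f).eval a = aeval (a • v) f := by
  have h : ((Polynomial.aeval a).comp (scaleHom v)) = aeval (a • v) := by
    apply MvPolynomial.algHom_ext
    intro i
    simp [scaleHom, mul_comm a]
  simpa [Polynomial.aeval_def, Polynomial.eval₂_eq_eval_map] using DFunLike.congr_fun h f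

theorem vanishes_mk_iff {R : Type*} [CommRing R] [Algebra R ℂ] (f : MvPolynomial E R)
    (v : E → ℂ) (hv : v ≠ 0) :
    Vanishes f (Projectivization.mk ℂ v hv) ↔ ∀ a : ℂ, a ≠ 0 → aeval (a • v) f = 0 := by
  constructor
  · intro h a ha
    refine h (a • v) (smul_ne_zero ha hv) ?_
    rw [Projectivization.mk_eq_mk_iff']
    exact ⟨a, rfl⟩
  · intro h w hw hwv
    rw [Projectivization.mk_eq_mk_iff'] at hwv
    obtain ⟨a, rfl⟩ := hwv
    exact h a fun ha => hw (by rw [ha, zero_smul])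

/-- A polynomial in one variable with infinitely many roots is zero. Vanishing at a point thus
becomes an equation in the domain `ℂ[X]`, even for inhomogeneous polynomials. -/
theorem vanishes_mk_iff_scaleHom (f : MvPolynomial E ℂ) (v : E → ℂ) (hv : v ≠ 0) :
    Vanishes f (Projectivization.mk ℂ v hv) ↔ scaleHom v f = 0 := by
  rw [vanishes_mk_iff]
  constructor
  · intro h
    apply Polynomial.eq_zero_of_infinite_isRoot
    refine Set.Infinite.mono (s := {0}ᶜ) ?_ (Set.finite_singleton (0 : ℂ)).infinite_compl
    intro a ha
    change Polynomial.IsRoot _ a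
    rw [Polynomial.IsRoot, eval_scaleHom]
    exact h a ha
  · intro h a _
    rw [← eval_scaleHom, h, Polynomial.eval_zero]

theorem vanishes_mul_iff (f g : MvPolynomial E ℂ) (p : CProj E) :
    Vanishes (f * g) p ↔ Vanishes f p ∨ Vanishes g p := by
  induction p using Projectivization.ind with
  | h v hv => simp only [vanishes_mk_iff_scaleHom, map_mul, mul_eq_zero]

theorem _root_.MvPolynomial.IsHomogeneous.aeval_smul {R : Type*} [CommRing R] [Algebra R ℂ]
    {f : MvPolynomial E R} {d : ℕ} (hf : f.IsHomogeneous d) (a : ℂ) (v : E → ℂ) :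
    MvPolynomial.aeval (a • v) f = a ^ d * MvPolynomial.aeval v f := by
  rw [aeval_def, aeval_def, eval₂_eq, eval₂_eq, Finset.mul_sum]
  refine Finset.sum_congr rfl fun m hm => ?_
  have hd : ∑ i ∈ m.support, m i = d := by
    simpa [Finsupp.weight_apply, Finsupp.sum] using hf (mem_support_iff.1 hm)
  simp only [Pi.smul_apply, smul_eq_mul, mul_pow, Finset.prod_mul_distrib,
    Finset.prod_pow_eq_pow_sum, hd]
  ring

theorem vanishes_mk_iff_of_isHomogeneous {R : Type*} [CommRing R] [Algebra R ℂ]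
    {f : MvPolynomial E R} {d : ℕ} (hf : f.IsHomogeneous d) (v : E → ℂ) (hv : v ≠ 0) :
    Vanishes f (Projectivization.mk ℂ v hv) ↔ aeval v f = 0 := by
  rw [vanishes_mk_iff]
  constructor
  · intro h
    simpa using h 1 one_ne_zero
  · intro h a _
    rw [hf.aeval_smul, h, mul_zero]

theorem coeff_scaleHom (v : E → ℂ) (f : MvPolynomial E ℂ) (n : ℕ) :
    (scaleHom v f).coeff n = aeval v (homogeneousComponent n f) := by
  have h1 : ∀ (g : MvPolynomial E ℂ) (d : ℕ), g.IsHomogeneous d →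
      scaleHom v g = Polynomial.C (aeval v g) * Polynomial.X ^ d := by
    intro g d hg
    apply Polynomial.funext
    intro a
    rw [eval_scaleHom, hg.aeval_smul]
    simp [mul_comm (a ^ d)]
  conv_lhs => rw [← sum_homogeneousComponent f]
  rw [map_sum, Polynomial.finsetSum_coeff]
  simp only [h1 _ _ (homogeneousComponent_isHomogeneous _ f), Polynomial.coeff_C_mul,
    Polynomial.coeff_X_pow, mul_ite, mul_one, mul_zero]
  rw [Finset.sum_ite_eq]
  split_ifs with h
  · rfl
  · rw [homogeneousComponent_eq_zero _ _ (by simpa using h), map_zero]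

/-- On the line spanned by `v`, the degree `n` component contributes exactly the coefficient of `X ^
n`. It follows that zero loci of arbitrary sets of polynomials are closed, although closed sets are
defined by homogeneous ones. -/
theorem vanishes_iff_homogeneousComponent (f : MvPolynomial E ℂ) (p : CProj E) :
    Vanishes f p ↔ ∀ n, Vanishes (homogeneousComponent n f) p := by
  induction p using Projectivization.ind with
  | h v hv =>
    simp only [vanishes_mk_iff_of_isHomogeneous (homogeneousComponent_isHomogeneous _ f),
      vanishes_mk_iff_scaleHom, Polynomial.ext_iff, coeff_scaleHom, Polynomial.coeff_zero]

theorem isClosed_iff_mem_algebraicSets {Z : Set (CProj E)} :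
    IsClosed Z ↔ Z ∈ algebraicSets E := by
  rw [← isOpen_compl_iff]
  change Zᶜᶜ ∈ algebraicSets E ↔ _
  rw [compl_compl]

theorem isClosed_zeroLocus (F : Set (MvPolynomial E ℂ)) : IsClosed (zeroLocus F) := by
  rw [isClosed_iff_mem_algebraicSets]
  refine ⟨{g | ∃ f ∈ F, ∃ n, g = homogeneousComponent n f}, ?_, ?_⟩
  · rintro _ ⟨f, -, n, rfl⟩
    exact ⟨n, homogeneousComponent_isHomogeneous n f⟩
  · ext p
    constructor
    · rintro h _ ⟨f, hf, n, rfl⟩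
      exact (vanishes_iff_homogeneousComponent f p).1 (h f hf) n
    · intro h f hf
      exact (vanishes_iff_homogeneousComponent f p).2 fun n => h _ ⟨f, hf, n, rfl⟩

theorem isClosed_iff_zeroLocus_vanishingIdeal {Z : Set (CProj E)} :
    IsClosed Z ↔ zeroLocus (vanishingIdeal Z : Set (MvPolynomial E ℂ)) = Z := by
  constructor
  · intro h
    obtain ⟨F, -, rfl⟩ := isClosed_iff_mem_algebraicSets.1 h
    exact Set.Subset.antisymm (fun p hp f hf => hp f fun q hq => hq f hf)
      fun p hp f hf => hf p hp
  · intro h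
    rw [← h]
    exact isClosed_zeroLocus _

theorem vanishingIdeal_anti {Z W : Set (CProj E)} (h : Z ⊆ W) :
    vanishingIdeal W ≤ vanishingIdeal Z := fun _ hf p hp => hf p (h hp)

theorem isPrime_vanishingIdeal {Z : Set (CProj E)} (hZ : IsIrreducible Z) :
    (vanishingIdeal Z).IsPrime := by
  obtain ⟨p, hp⟩ := hZ.nonempty
  refine Ideal.isPrime_iff.2 ⟨?_, ?_⟩
  · rw [Ideal.ne_top_iff_one]
    intro h
    simpa using h p hp p.rep p.rep_nonzero p.mk_rep
  · intro f g hfg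
    have key := isPreirreducible_iff_isClosed_union_isClosed.1 hZ.isPreirreducible
      (zeroLocus {f}) (zeroLocus {g}) (isClosed_zeroLocus _) (isClosed_zeroLocus _) (by
        intro q hq
        refine ((vanishes_mul_iff f g q).1 (hfg q hq)).imp ?_ ?_
        · rintro h _ rfl
          exact h
        · rintro h _ rfl
          exact h)
    exact key.imp (fun h q hq => h hq f rfl) (fun h q hq => h hq g rfl)

/-- The ideal of the polynomials without constant term. -/
noncomputable def irrelevantIdeal (E : Type*) : Ideal (MvPolynomial E ℂ) :=
  RingHom.ker (constantCoeff : MvPolynomial E ℂ →+* ℂ)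

instance isPrime_irrelevantIdeal : (irrelevantIdeal E).IsPrime := RingHom.ker_isPrime _

/-- The constant term is the value at the origin, which lies on every line, so it is zero. The
inclusion is strict because some coordinate of a projective point is nonzero. -/
theorem vanishingIdeal_lt_irrelevantIdeal {Z : Set (CProj E)} (hZ : Z.Nonempty) :
    vanishingIdeal Z < irrelevantIdeal E := by
  obtain ⟨p, hp⟩ := hZ
  refine lt_of_le_of_ne ?_ ?_
  · intro f hf
    have h := hf p hp
    rw [← p.mk_rep, vanishes_mk_iff_scaleHom] at h
    have h0 := eval_scaleHom p.rep f 0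
    rw [h, Polynomial.eval_zero, zero_smul] at h0
    change constantCoeff f = 0
    rw [h0]
    simp [constantCoeff_eq]
  · intro h
    apply p.rep_nonzero
    funext e
    have he : (X e : MvPolynomial E ℂ) ∈ vanishingIdeal Z := by
      rw [h]
      change constantCoeff (X e) = 0
      simp
    simpa using he p hp p.rep p.rep_nonzero p.mk_rep

end Vanishing

/-! ### Linear embeddings of projective spaces. -/

section Linear

variable {σ E : Type*} [Fintype σ]

/-- The pullback of polynomials along a linear map. -/
noncomputable def pullback (A : (σ → ℂ) →ₗ[ℂ] (E → ℂ)) :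
    MvPolynomial E ℂ →ₐ[ℂ] MvPolynomial σ ℂ :=
  open Classical in aeval fun e => ∑ s, C (A (Pi.single s 1) e) * X s

theorem aeval_pullback (A : (σ → ℂ) →ₗ[ℂ] (E → ℂ)) (v : σ → ℂ) (f : MvPolynomial E ℂ) :
    aeval v (pullback A f) = aeval (A v) f := by
  classical
  have h : (aeval v).comp (pullback A) = aeval (A v) := by
    apply MvPolynomial.algHom_ext
    intro e
    have hv : v = ∑ s, v s • Pi.single (M := fun _ => ℂ) s 1 := by
      funext t
      simp [Finset.sum_apply, Pi.single_apply]
    conv_rhs => rw [hv]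
    simp [pullback, Finset.sum_apply, mul_comm]
  exact DFunLike.congr_fun h f

theorem isHomogeneous_pullback (A : (σ → ℂ) →ₗ[ℂ] (E → ℂ)) {f : MvPolynomial E ℂ} {d : ℕ}
    (hf : f.IsHomogeneous d) : (pullback A f).IsHomogeneous d := by
  classical
  have h := hf.aeval (S := ℂ) (g := fun e => ∑ s, C (A (Pi.single s 1) e) * X s) (n := 1) ?_
  · rw [one_mul] at h
    unfold pullback
    convert! h
  · intro e
    refine IsHomogeneous.sum _ _ _ fun s _ => ?_
    simpa using (isHomogeneous_C σ (A (Pi.single s 1) e)).mul (isHomogeneous_X ℂ s)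

variable {A : (σ → ℂ) →ₗ[ℂ] (E → ℂ)} (hA : Function.Injective A)

theorem vanishes_map_iff (f : MvPolynomial E ℂ) (p : CProj σ) :
    Vanishes f (Projectivization.map A hA p) ↔ Vanishes (pullback A f) p := by
  induction p using Projectivization.ind with
  | h v hv =>
    rw [Projectivization.map_mk, vanishes_mk_iff, vanishes_mk_iff]
    simp only [aeval_pullback, map_smul]

theorem continuous_map : Continuous (Projectivization.map A hA) := by
  rw [continuous_iff_isClosed]
  intro Z hZ
  rw [← isClosed_iff_zeroLocus_vanishingIdeal.1 hZ]
  have h : Projectivization.map A hA ⁻¹' zeroLocus (vanishingIdeal Z : Set (MvPolynomial E ℂ)) =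
      zeroLocus (pullback A '' (vanishingIdeal Z : Set (MvPolynomial E ℂ))) := by
    ext p
    simp only [zeroLocus, Set.mem_preimage, Set.mem_ofPred_eq, vanishes_map_iff,
      Set.forall_mem_image]
  rw [h]
  exact isClosed_zeroLocus _

/-- A linear left inverse `B` of `A` extends equations to the larger space: pulled back along `B`
and then restricted along `A`, they are unchanged. -/
theorem isInducing_map [Fintype E] : Topology.IsInducing (Projectivization.map A hA) := by
  obtain ⟨B, hB⟩ := A.exists_leftInverse_of_injective (LinearMap.ker_eq_bot.2 hA)
  refine ⟨TopologicalSpace.ext_isClosed fun Z => ?_⟩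
  rw [isClosed_induced_iff]
  constructor
  · intro hZ
    refine ⟨zeroLocus (pullback B '' (vanishingIdeal Z : Set (MvPolynomial σ ℂ))),
      isClosed_zeroLocus _, ?_⟩
    conv_rhs => rw [← isClosed_iff_zeroLocus_vanishingIdeal.1 hZ]
    ext p
    simp only [zeroLocus, Set.mem_preimage, Set.mem_ofPred_eq, vanishes_map_iff,
      Set.forall_mem_image]
    refine forall₂_congr fun f _ => ?_
    induction p using Projectivization.ind with
    | h v hv =>
      simp only [vanishes_mk_iff, aeval_pullback]
      have hBA : ∀ w, B (A w) = w := fun w => LinearMap.congr_fun hB w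
      simp only [hBA]
  · rintro ⟨W, hW, rfl⟩
    exact hW.preimage (continuous_map hA)

end Linear

section Linear

variable {σ E : Type*} {A : (σ → ℂ) →ₗ[ℂ] (E → ℂ)} (hA : Function.Injective A)

theorem mk_mem_range_map_iff (v : E → ℂ) (hv : v ≠ 0) :
    Projectivization.mk ℂ v hv ∈ Set.range (Projectivization.map A hA) ↔
      v ∈ LinearMap.range A := by
  constructor
  · rintro ⟨p, hp⟩
    induction p using Projectivization.ind with
    | h w hw =>
      rw [Projectivization.map_mk, Projectivization.mk_eq_mk_iff'] at hp
      obtain ⟨a, ha⟩ := hp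
      have h1 : a ≠ 0 := by
        rintro rfl
        apply hw
        apply hA
        rw [← ha, zero_smul, map_zero]
      exact ⟨a⁻¹ • w, by rw [map_smul, ← ha, inv_smul_smul₀ h1]⟩
  · rintro ⟨w, rfl⟩
    have hw : w ≠ 0 := by
      rintro rfl
      exact hv (map_zero A)
    exact ⟨Projectivization.mk ℂ w hw, Projectivization.map_mk ..⟩

theorem isClosed_range_map [Fintype σ] [Fintype E] : IsClosed (Set.range (Projectivization.map A hA)) := by
  obtain ⟨B, hB⟩ := A.exists_leftInverse_of_injective (LinearMap.ker_eq_bot.2 hA)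
  have hBA : ∀ w, B (A w) = w := fun w => LinearMap.congr_fun hB w
  -- The range of `A` is the fixed space of the projection `A ∘ B`, which is cut out by linear
  -- forms.
  have h : Set.range (Projectivization.map A hA) =
      zeroLocus (Set.range fun e => pullback B (pullback A (X e)) - X e) := by
    ext p
    induction p using Projectivization.ind with
    | h v hv =>
      simp only [mk_mem_range_map_iff, zeroLocus, Set.mem_ofPred_eq, Set.forall_mem_range]
      have hX : ∀ e, (pullback B (pullback A (X e)) - X e).IsHomogeneous 1 := fun e =>
        (isHomogeneous_pullback B (isHomogeneous_pullback A (isHomogeneous_X ℂ e))).sub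
          (isHomogeneous_X ℂ e)
      simp only [vanishes_mk_iff_of_isHomogeneous (hX _), map_sub, aeval_pullback, aeval_X,
        sub_eq_zero]
      constructor
      · rintro ⟨w, rfl⟩ e
        rw [hBA]
      · intro h
        exact ⟨B v, funext h⟩
  rw [h]
  exact isClosed_zeroLocus _

theorem isClosedEmbedding_map [Fintype σ] [Fintype E] :
    Topology.IsClosedEmbedding (Projectivization.map A hA) :=
  ⟨⟨isInducing_map hA, Projectivization.map_injective A hA⟩, isClosed_range_map hA⟩

end Linear

/-! ### The dimension of projective space. -/

section Dimension

variable {σ : Type*}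

instance nonempty [Nonempty σ] : Nonempty (CProj σ) :=
  ⟨Projectivization.mk ℂ (fun _ => 1) fun h => one_ne_zero (congrFun h (Classical.arbitrary σ))⟩

theorem eq_zero_of_forall_vanishes {f : MvPolynomial σ ℂ} [Nonempty σ]
    (h : ∀ p : CProj σ, Vanishes f p) : f = 0 := by
  refine MvPolynomial.funext fun v => ?_
  rw [map_zero]
  by_cases hv : v = 0
  · subst hv
    obtain ⟨w, hw⟩ := exists_ne (0 : σ → ℂ)
    have h1 := (vanishes_mk_iff_scaleHom f w hw).1 (h _)
    have h2 := eval_scaleHom w f 0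
    rw [h1, Polynomial.eval_zero, zero_smul] at h2
    simpa [aeval_def] using h2.symm
  · have := h (Projectivization.mk ℂ v hv) v hv rfl
    simpa [aeval_def] using this

instance irreducibleSpace [Nonempty σ] : IrreducibleSpace (CProj σ) where
  toNonempty := inferInstance
  isPreirreducible_univ := by
    rw [isPreirreducible_iff_isClosed_union_isClosed]
    intro Z W hZ hW h
    by_contra! hne
    obtain ⟨h1, h2⟩ := hne
    rw [← isClosed_iff_zeroLocus_vanishingIdeal.1 hZ] at h1
    rw [← isClosed_iff_zeroLocus_vanishingIdeal.1 hW] at h2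
    obtain ⟨p, -, hp⟩ := Set.not_subset.1 h1
    obtain ⟨q, -, hq⟩ := Set.not_subset.1 h2
    simp only [zeroLocus, Set.mem_ofPred_eq, not_forall] at hp hq
    obtain ⟨f, hf, hfp⟩ := hp
    obtain ⟨g, hg, hgq⟩ := hq
    have hfg : f * g = 0 := eq_zero_of_forall_vanishes fun r =>
      (vanishes_mul_iff f g r).2 ((h (Set.mem_univ r)).imp (hf r) (hg r))
    rcases mul_eq_zero.1 hfg with rfl | rfl
    · exact hfp fun _ _ _ => map_zero _
    · exact hgq fun _ _ _ => map_zero _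

/-- Vanishing ideals turn chains of irreducible closed sets into chains of primes of the polynomial
ring. The irrelevant ideal lies strictly above all of these primes and accounts for the extra 1; it
is the image of the added bottom element. -/
theorem krullDim_add_one_le [Fintype σ] [Nonempty σ] :
    topologicalKrullDim (CProj σ) + 1 ≤ Fintype.card σ := by
  have : Nonempty (TopologicalSpace.IrreducibleCloseds (CProj σ)) :=
    ⟨⟨Set.univ, IrreducibleSpace.isIrreducible_univ _, isClosed_univ⟩⟩
  have h1 : ringKrullDim (MvPolynomial σ ℂ) = Fintype.card σ := by
    rw [MvPolynomial.ringKrullDim_of_isNoetherianRing, ringKrullDim_eq_zero_of_field, zero_add,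
      Nat.card_eq_fintype_card]
  rw [← h1, topologicalKrullDim, ← Order.krullDim_withBot, ringKrullDim,
    ← Order.krullDim_orderDual (α := PrimeSpectrum _)]
  let F : WithBot (TopologicalSpace.IrreducibleCloseds (CProj σ)) →
      (PrimeSpectrum (MvPolynomial σ ℂ))ᵒᵈ := fun Z =>
    OrderDual.toDual (Z.recBotCoe ⟨irrelevantIdeal σ, inferInstance⟩
      fun Z => ⟨vanishingIdeal (Z : Set (CProj σ)), isPrime_vanishingIdeal Z.isIrreducible⟩)
  refine Order.krullDim_le_of_strictMono F ?_
  intro Z W hZW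
  induction W with
  | bot => exact absurd hZW not_lt_bot
  | coe W =>
    induction Z with
    | bot =>
      change vanishingIdeal (W : Set (CProj σ)) < irrelevantIdeal σ
      exact vanishingIdeal_lt_irrelevantIdeal W.isIrreducible.nonempty
    | coe Z =>
      change vanishingIdeal (W : Set (CProj σ)) < vanishingIdeal (Z : Set (CProj σ))
      have hlt : Z < W := WithBot.coe_lt_coe.1 hZW
      refine lt_of_le_of_ne (vanishingIdeal_anti hlt.le) fun heq => hlt.ne ?_
      apply SetLike.coe_injective
      rw [← isClosed_iff_zeroLocus_vanishingIdeal.1 Z.isClosed,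
        ← isClosed_iff_zeroLocus_vanishingIdeal.1 W.isClosed, heq]

/-- A chain in `Y` maps to a chain inside a proper closed subset of `X`, so the whole space `X` can
be put on top of it. -/
theorem _root_.Topology.IsClosedEmbedding.topologicalKrullDim_add_one_le {X Y : Type*}
    [TopologicalSpace X] [TopologicalSpace Y] [IrreducibleSpace X] [IrreducibleSpace Y]
    {f : Y → X} (hf : Topology.IsClosedEmbedding f) (hne : Set.range f ≠ Set.univ) :
    topologicalKrullDim Y + 1 ≤ topologicalKrullDim X := by
  have : Nonempty (TopologicalSpace.IrreducibleCloseds Y) :=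
    ⟨⟨Set.univ, IrreducibleSpace.isIrreducible_univ _, isClosed_univ⟩⟩
  rw [topologicalKrullDim, topologicalKrullDim, ← Order.krullDim_WithTop]
  let F : WithTop (TopologicalSpace.IrreducibleCloseds Y) →
      TopologicalSpace.IrreducibleCloseds X := fun Z =>
    Z.recTopCoe ⟨Set.univ, IrreducibleSpace.isIrreducible_univ _, isClosed_univ⟩
      (TopologicalSpace.IrreducibleCloseds.map f hf.continuous)
  refine Order.krullDim_le_of_strictMono F ?_
  intro Z W hZW
  induction Z with
  | top => exact absurd hZW not_top_lt
  | coe Z =>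
    induction W with
    | coe W =>
      exact TopologicalSpace.IrreducibleCloseds.map_strictMono_of_isInducing hf.isInducing
        (WithTop.coe_lt_coe.1 hZW)
    | top =>
      change TopologicalSpace.IrreducibleCloseds.map f hf.continuous Z <
        (⟨Set.univ, IrreducibleSpace.isIrreducible_univ _, isClosed_univ⟩ :
          TopologicalSpace.IrreducibleCloseds X)
      refine lt_of_le_of_ne (fun x _ => Set.mem_univ x) fun h => hne ?_
      have h1 : closure (f '' Z) = Set.univ := congrArg SetLike.coe h
      rw [Set.eq_univ_iff_forall] at h1 ⊢
      intro x
      exact closure_minimal (Set.image_subset_range f Z) hf.isClosed_range (h1 x)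

theorem natCast_le_topologicalKrullDim_fin (n : ℕ) :
    (n : WithBot ℕ∞) ≤ topologicalKrullDim (CProj (Fin (n + 1))) := by
  induction n with
  | zero =>
    have : Nonempty (TopologicalSpace.IrreducibleCloseds (CProj (Fin (0 + 1)))) :=
      ⟨⟨Set.univ, IrreducibleSpace.isIrreducible_univ _, isClosed_univ⟩⟩
    exact Order.krullDim_nonneg
  | succ n ih =>
    -- The hyperplane on which the first coordinate is zero.
    let A : (Fin (n + 1) → ℂ) →ₗ[ℂ] (Fin (n + 1 + 1) → ℂ) :=
      { toFun := fun v => Fin.cons 0 v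
        map_add' := by
          intro v w
          funext i
          refine Fin.cases ?_ (fun i => ?_) i <;> simp
        map_smul' := by
          intro a v
          funext i
          refine Fin.cases ?_ (fun i => ?_) i <;> simp }
    have hA : Function.Injective A := fun v w h =>
      (Fin.cons_injective2 (α := fun _ => ℂ) h).2
    have hne : Set.range (Projectivization.map A hA) ≠ Set.univ := by
      intro h
      have hv : (fun _ => 1 : Fin (n + 1 + 1) → ℂ) ≠ 0 := fun h => one_ne_zero (congrFun h 0)
      have h1 := (mk_mem_range_map_iff hA _ hv).1 (h ▸ Set.mem_univ _)
      obtain ⟨w, hw⟩ := h1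
      have h2 := congrFun hw 0
      simp [A] at h2
    refine le_trans ?_ ((isClosedEmbedding_map hA).topologicalKrullDim_add_one_le hne)
    push_cast
    gcongr

theorem topologicalKrullDim_add_one [Fintype σ] [Nonempty σ] :
    topologicalKrullDim (CProj σ) + 1 = Fintype.card σ := by
  refine le_antisymm krullDim_add_one_le ?_
  obtain ⟨n, hn⟩ := Nat.exists_eq_succ_of_ne_zero (Fintype.card_ne_zero (α := σ))
  let e := Fintype.equivFinOfCardEq hn
  have h := (isInducing_map (A := (LinearEquiv.funCongrLeft ℂ ℂ e).toLinearMap)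
    (LinearEquiv.funCongrLeft ℂ ℂ e).injective).topologicalKrullDim_le
  rw [hn]
  push_cast
  gcongr
  exact (natCast_le_topologicalKrullDim_fin n).trans h

theorem topologicalKrullDim_eq [Fintype σ] {n : ℕ} (h : Fintype.card σ = n + 1) :
    topologicalKrullDim (CProj σ) = n := by
  have : Nonempty σ := Fintype.card_pos_iff.1 (by omega)
  have h1 := topologicalKrullDim_add_one (σ := σ)
  rw [h] at h1
  generalize topologicalKrullDim (CProj σ) = d at h1
  induction d with
  | bot =>
    rw [WithBot.bot_add] at h1
    exact absurd h1 (WithBot.bot_ne_coe (a := ((n + 1 : ℕ) : ℕ∞)))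
  | coe d =>
    have h2 : d + 1 = n + 1 := by exact_mod_cast h1
    have h3 : d = n := by simpa using h2
    exact_mod_cast h3

end Dimension

end CProj

/-! ### Cyclic sequences and periodic orbits. -/

namespace Cycle

variable {α : Type*} {r : α → α → Prop}

theorem exists_eq_coe_cons {c : Cycle α} {x : α} (hx : x ∈ c) :
    ∃ l : List α, c = ((x :: l : List α) : Cycle α) := by
  induction c using Quotient.inductionOn with
  | h l =>
    obtain ⟨s, t, rfl⟩ := List.append_of_mem (mem_coe_iff.1 hx)
    exact ⟨t ++ s, coe_eq_coe.2 (by simpa using List.isRotated_append (l := s) (l' := x :: t))⟩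

theorem Chain.imp_of_mem {s : α → α → Prop} {c : Cycle α} (hc : c.Chain r)
    (h : ∀ x ∈ c, ∀ y ∈ c, r x y → s x y) : c.Chain s := by
  induction c using Quotient.inductionOn with
  | h l =>
    cases l with
    | nil => exact Chain.nil s
    | cons a l =>
      refine List.IsChain.imp_of_mem_imp (fun x y hx hy => h x ?_ y ?_) hc <;>
      · refine mem_coe_iff.2 ?_
        simp only [List.cons_append, List.mem_cons, List.mem_append, List.not_mem_nil] at hx hy ⊢
        tauto

theorem Chain.exists_next {c : Cycle α} (hc : c.Chain r) {x : α} (hx : x ∈ c) :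
    ∃ y ∈ c, r x y := by
  obtain ⟨l, rfl⟩ := exists_eq_coe_cons hx
  cases l with
  | nil => exact ⟨x, hx, (chain_singleton r x).1 hc⟩
  | cons b l =>
    rw [chain_coe_cons, List.cons_append, List.isChain_cons_cons] at hc
    exact ⟨b, by simp, hc.1⟩

theorem Chain.exists_prev {c : Cycle α} (hc : c.Chain r) {x : α} (hx : x ∈ c) :
    ∃ y ∈ c, r y x := by
  obtain ⟨l, rfl⟩ := exists_eq_coe_cons hx
  rw [chain_ne_nil r (List.cons_ne_nil x l), List.isChain_cons_cons] at hc
  exact ⟨_, mem_coe_iff.2 (List.getLast_mem (List.cons_ne_nil x l)), hc.1⟩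

/-- If every entry is followed by its image under `g`, then one entry determines the whole cyclic
sequence. This is how two directed cycles with a common edge are shown to be equal. -/
theorem eq_periodicOrbit {g : α → α} {c : Cycle α} (hn : c.Nodup)
    (hc : c.Chain fun x y => y = g x) {x : α} (hx : x ∈ c) : c = Function.periodicOrbit g x := by
  obtain ⟨l, rfl⟩ := exists_eq_coe_cons hx
  rw [chain_coe_cons, List.isChain_iff_getElem] at hc
  have hiter : ∀ i (hi : i < (x :: (l ++ [x])).length), (x :: (l ++ [x]))[i] = g^[i] x := by
    intro i
    induction i with
    | zero => intro _; rfl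
    | succ i ih =>
      intro hi
      rw [hc i hi, ih (by omega), Function.iterate_succ_apply']
  have hget : ∀ i (hi : i < (x :: l).length), (x :: l)[i] = g^[i] x := by
    intro i hi
    rw [← hiter i (by simp at hi ⊢; omega)]
    simp only [← List.cons_append]
    rw [List.getElem_append_left]
  have hper : Function.IsPeriodicPt g (l.length + 1) x := by
    change g^[l.length + 1] x = x
    rw [← hiter (l.length + 1) (by simp)]
    simp
  have hle : Function.minimalPeriod g x ≤ l.length + 1 := hper.minimalPeriod_le (by omega)
  have hpos : 0 < Function.minimalPeriod g x := hper.minimalPeriod_pos (by omega)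
  -- A smaller period would make `x` occur twice in a list without duplicates.
  have hmin : Function.minimalPeriod g x = l.length + 1 := by
    by_contra hne
    have hlt : Function.minimalPeriod g x < (x :: l).length := by
      simp only [List.length_cons]
      omega
    have h1 := hget _ hlt
    rw [Function.iterate_minimalPeriod] at h1
    have h2 := (List.Nodup.getElem_inj_iff (nodup_coe_iff.1 hn) (hi := hlt)
      (hj := (by simp : 0 < (x :: l).length))).1 h1
    omega
  rw [Function.periodicOrbit_def, hmin]
  congr 1
  refine List.ext_getElem (by simp) fun i h1 h2 => ?_
  rw [hget i h1, List.getElem_map, List.getElem_range]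

end Cycle

/-! ### Directed cycles and the edge sets of packings. -/

namespace DirectedGraph

variable {V E : Type*} {G : DirectedGraph V E}

namespace DirectedCycle

variable (C : G.DirectedCycle)

theorem exists_mem : ∃ e, e ∈ C.1 := by
  obtain ⟨c, h0, h1, h2⟩ := C
  induction c using Cycle.induction_on with
  | nil => exact absurd rfl h0
  | cons a l _ => exact ⟨a, by simp⟩

variable {C}

theorem eq_of_init_eq {x y : E} (hx : x ∈ C.1) (hy : y ∈ C.1) (h : G.init x = G.init y) :
    x = y := by
  obtain ⟨c, h0, h1, h2⟩ := C
  induction c using Quotient.inductionOn with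
  | h l => exact List.inj_on_of_nodup_map (Cycle.nodup_coe_iff.1 h2) hx hy h

theorem nodup (C : G.DirectedCycle) : C.1.Nodup := by
  obtain ⟨c, h0, h1, h2⟩ := C
  induction c using Quotient.inductionOn with
  | h l => exact List.Nodup.of_map _ h2

theorem exists_next {x : E} (hx : x ∈ C.1) : ∃ y ∈ C.1, G.term x = G.init y :=
  C.2.2.1.exists_next hx

theorem exists_prev {x : E} (hx : x ∈ C.1) : ∃ y ∈ C.1, G.term y = G.init x :=
  C.2.2.1.exists_prev hx

theorem mem_vertices {v : V} : v ∈ C.vertices ↔ ∃ x ∈ C.1, G.init x = v := by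
  change v ∈ C.1.map G.init ↔ _
  rw [Cycle.mem_map]

theorem init_mem_vertices {x : E} (hx : x ∈ C.1) : G.init x ∈ C.vertices :=
  mem_vertices.2 ⟨x, hx, rfl⟩

theorem term_mem_vertices {x : E} (hx : x ∈ C.1) : G.term x ∈ C.vertices := by
  obtain ⟨y, hy, h⟩ := exists_next hx
  exact mem_vertices.2 ⟨y, hy, h.symm⟩

/-- The successor map on the finite set of edges of `C` is surjective, since each edge has a
predecessor. So it is injective, and edges with the same terminal vertex have the same successor. -/
theorem eq_of_term_eq [Finite E] {x y : E} (hx : x ∈ C.1) (hy : y ∈ C.1)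
    (h : G.term x = G.term y) : x = y := by
  choose g hg hgt using fun z : {z // z ∈ C.1} => exists_next z.2
  let g' : {z // z ∈ C.1} → {z // z ∈ C.1} := fun z => ⟨g z, hg z⟩
  have hsurj : Function.Surjective g' := by
    rintro ⟨z, hz⟩
    obtain ⟨w, hw, hwz⟩ := exists_prev hz
    exact ⟨⟨w, hw⟩, Subtype.ext (eq_of_init_eq (hg _) hz ((hgt ⟨w, hw⟩).symm.trans hwz))⟩
  have hinj := Finite.injective_iff_surjective.2 hsurj
  have h1 : g' ⟨x, hx⟩ = g' ⟨y, hy⟩ := Subtype.ext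
    (eq_of_init_eq (hg _) (hg _) ((hgt ⟨x, hx⟩).symm.trans (h.trans (hgt ⟨y, hy⟩))))
  exact congrArg Subtype.val (hinj h1)

end DirectedCycle

/-- The set of edges of a collection of cycles. -/
def edgeSet (𝒞 : Finset G.DirectedCycle) : Set E := {e | ∃ C ∈ 𝒞, e ∈ C.1}

namespace PairwiseDisjointCycles

variable {𝒞 : Finset G.DirectedCycle} (h𝒞 : G.PairwiseDisjointCycles 𝒞)
include h𝒞

theorem eq_of_mem_vertices {C D : G.DirectedCycle} (hC : C ∈ 𝒞) (hD : D ∈ 𝒞) {v : V}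
    (hvC : v ∈ C.vertices) (hvD : v ∈ D.vertices) : C = D := by
  by_contra hne
  exact Set.disjoint_left.1 (h𝒞 hC hD hne) hvC hvD

theorem eq_of_mem {C D : G.DirectedCycle} (hC : C ∈ 𝒞) (hD : D ∈ 𝒞) {e : E}
    (heC : e ∈ C.1) (heD : e ∈ D.1) : C = D :=
  h𝒞.eq_of_mem_vertices hC hD (DirectedCycle.init_mem_vertices heC)
    (DirectedCycle.init_mem_vertices heD)

theorem eq_of_init_eq {x y : E} (hx : x ∈ edgeSet 𝒞) (hy : y ∈ edgeSet 𝒞)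
    (h : G.init x = G.init y) : x = y := by
  obtain ⟨C, hC, hx⟩ := hx
  obtain ⟨D, hD, hy⟩ := hy
  obtain rfl := h𝒞.eq_of_mem_vertices hC hD (DirectedCycle.init_mem_vertices hx)
    (h ▸ DirectedCycle.init_mem_vertices hy)
  exact DirectedCycle.eq_of_init_eq hx hy h

theorem eq_of_term_eq [Finite E] {x y : E} (hx : x ∈ edgeSet 𝒞) (hy : y ∈ edgeSet 𝒞)
    (h : G.term x = G.term y) : x = y := by
  obtain ⟨C, hC, hx⟩ := hx
  obtain ⟨D, hD, hy⟩ := hy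
  obtain rfl := h𝒞.eq_of_mem_vertices hC hD (DirectedCycle.term_mem_vertices hx)
    (h ▸ DirectedCycle.term_mem_vertices hy)
  exact DirectedCycle.eq_of_term_eq hx hy h

theorem mono {𝒟 : Finset G.DirectedCycle} (h : 𝒟 ⊆ 𝒞) : G.PairwiseDisjointCycles 𝒟 :=
  Set.Pairwise.mono (Finset.coe_subset.2 h) h𝒞

/-- A directed cycle on the edges of a collection of disjoint cycles is a member of it. -/
theorem mem_of_subset_edgeSet {C : G.DirectedCycle} (hC : ∀ e ∈ C.1, e ∈ edgeSet 𝒞) :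
    C ∈ 𝒞 := by
  classical
  -- Inside the edge set of a packing the successor of an edge is unique. Hence `C`, and the member
  -- `D` of the packing that contains a given edge `e` of `C`, are both the orbit of `e` under `g`.
  let g : E → E := fun x =>
    if h : ∃ y ∈ edgeSet 𝒞, G.term x = G.init y then h.choose else x
  have hg : ∀ x y, y ∈ edgeSet 𝒞 → G.term x = G.init y → y = g x := by
    intro x y hy hxy
    have h : ∃ y ∈ edgeSet 𝒞, G.term x = G.init y := ⟨y, hy, hxy⟩
    simp only [g, dif_pos h]
    exact h𝒞.eq_of_init_eq hy h.choose_spec.1 (hxy.symm.trans h.choose_spec.2)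
  have horb : ∀ D : G.DirectedCycle, (∀ e ∈ D.1, e ∈ edgeSet 𝒞) → ∀ e ∈ D.1,
      D.1 = Function.periodicOrbit g e := fun D hD e he =>
    Cycle.eq_periodicOrbit D.nodup (D.2.2.1.imp_of_mem fun x _ y hy hxy => hg x y (hD y hy) hxy) he
  obtain ⟨e, he⟩ := C.exists_mem
  obtain ⟨D, hD, heD⟩ := hC e he
  have : C = D := Subtype.ext
    ((horb C hC e he).trans (horb D (fun f hf => ⟨D, hD, hf⟩) e heD).symm)
  exact this ▸ hD

theorem subset_of_edgeSet_subset {𝒟 : Finset G.DirectedCycle} (h : edgeSet 𝒟 ⊆ edgeSet 𝒞) :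
    𝒟 ⊆ 𝒞 := fun C hC => h𝒞.mem_of_subset_edgeSet fun _ he => h ⟨C, hC, he⟩

end PairwiseDisjointCycles

/-- A set of edges with at most one edge out of and into each vertex, in which each edge has a
successor, is the edge set of a collection of disjoint cycles. -/
theorem exists_pairwiseDisjointCycles_edgeSet_eq [Finite E] {S : Set E}
    (hinit : Set.InjOn G.init S) (hterm : Set.InjOn G.term S)
    (hnext : ∀ x ∈ S, ∃ y ∈ S, G.term x = G.init y) :
    ∃ 𝒞 : Finset G.DirectedCycle, G.PairwiseDisjointCycles 𝒞 ∧ edgeSet 𝒞 = S := by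
  classical
  choose! n hn hnt using hnext
  -- Extended by the identity outside `S`, the successor map is an injection of the finite type `E`
  -- into itself, so every edge is periodic. The required cycles are the orbits of the elements of
  -- `S`.
  let g : E → E := fun x => if x ∈ S then n x else x
  have hgS : ∀ x ∈ S, g x ∈ S := fun x hx => by simpa only [g, if_pos hx] using hn x hx
  have hgt : ∀ x ∈ S, G.term x = G.init (g x) := fun x hx => by
    simpa only [g, if_pos hx] using hnt x hx
  have hginj : Function.Injective g := by
    intro x y hxy
    by_cases hx : x ∈ S <;> by_cases hy : y ∈ S
    · exact hterm hx hy (by rw [hgt x hx, hgt y hy, hxy])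
    · exact absurd (hgS x hx) (by rw [hxy]; simpa only [g, if_neg hy] using hy)
    · exact absurd (hgS y hy) (by rw [← hxy]; simpa only [g, if_neg hx] using hx)
    · simpa only [g, if_neg hx, if_neg hy] using hxy
  have hper : ∀ x, x ∈ Function.periodicPts g := hginj.mem_periodicPts
  have hiter : ∀ x ∈ S, ∀ k, g^[k] x ∈ S := by
    intro x hx k
    induction k with
    | zero => exact hx
    | succ k ih =>
      rw [Function.iterate_succ_apply']
      exact hgS _ ih
  have horbS : ∀ x ∈ S, ∀ y ∈ Function.periodicOrbit g x, y ∈ S := by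
    intro x hx y hy
    obtain ⟨k, rfl⟩ := (Function.mem_periodicOrbit_iff (hper x)).1 hy
    exact hiter x hx k
  have hcyc : ∀ x : S, G.IsDirectedCycle (Function.periodicOrbit g x.1) := by
    rintro ⟨x, hx⟩
    refine ⟨?_, ?_, ?_⟩
    · rw [Ne, Function.periodicOrbit_eq_nil_iff_not_periodic_pt, not_not]
      exact hper x
    · rw [Function.periodicOrbit_chain' _ (hper x)]
      intro k
      rw [Function.iterate_succ_apply']
      exact hgt _ (hiter x hx k)
    · have hnd := Function.nodup_periodicOrbit (f := g) (x := x)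
      rw [Function.periodicOrbit_def] at hnd ⊢
      refine List.Nodup.map_on ?_ hnd
      intro y hy z hz hyz
      exact hinit (horbS x hx y hy) (horbS x hx z hz) hyz
  have : Fintype S := Fintype.ofFinite S
  refine ⟨Finset.univ.image fun x : S => (⟨_, hcyc x⟩ : G.DirectedCycle), ?_, ?_⟩
  · intro C hC D hD hne
    obtain ⟨⟨x, hx⟩, -, rfl⟩ := Finset.mem_image.1 (Finset.mem_coe.1 hC)
    obtain ⟨⟨y, hy⟩, -, rfl⟩ := Finset.mem_image.1 (Finset.mem_coe.1 hD)
    rw [Set.disjoint_left]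
    intro v hvx hvy
    apply hne
    obtain ⟨z, hz, rfl⟩ := DirectedCycle.mem_vertices.1 hvx
    obtain ⟨w, hw, hwz⟩ := DirectedCycle.mem_vertices.1 hvy
    obtain rfl := hinit (horbS y hy w hw) (horbS x hx z hz) hwz
    obtain ⟨i, hi⟩ := (Function.mem_periodicOrbit_iff (hper x)).1 hz
    obtain ⟨j, hj⟩ := (Function.mem_periodicOrbit_iff (hper y)).1 hw
    refine Subtype.ext ?_
    change Function.periodicOrbit g x = Function.periodicOrbit g y
    rw [← Function.periodicOrbit_apply_iterate_eq (hper x) i, hi, ← hj,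
      Function.periodicOrbit_apply_iterate_eq (hper y)]
  · ext e
    constructor
    · rintro ⟨C, hC, he⟩
      obtain ⟨⟨x, hx⟩, -, rfl⟩ := Finset.mem_image.1 hC
      exact horbS x hx e he
    · intro he
      exact ⟨_, Finset.mem_image.2 ⟨⟨e, he⟩, Finset.mem_univ _, rfl⟩,
        Function.self_mem_periodicOrbit (hper e)⟩

end DirectedGraph

namespace DirectedGraph

open MvPolynomial

variable {V E : Type*} {G : DirectedGraph V E}

section ElementarySymmetric

/-! ### Elementary symmetric polynomials -/

theorem aeval_elemSymm (s : Finset E) (l : ℕ) (v : E → ℂ) :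
    aeval v (elemSymm s l) = ∑ t ∈ s.powersetCard l, ∏ x ∈ t, v x := by
  simp [elemSymm]

theorem aeval_elemSymm_one (s : Finset E) (v : E → ℂ) :
    aeval v (elemSymm s 1) = ∑ x ∈ s, v x := by
  simp [aeval_elemSymm, Finset.powersetCard_one]

/-- If `l ≥ 2` values are nonzero, the only nonzero term of the `l`-th elementary symmetric
polynomial is their product. Conversely, with at most one nonzero value, every product of two or
more factors is zero. -/
theorem forall_aeval_elemSymm_eq_zero_iff (s : Finset E) (v : E → ℂ) :
    (∀ l, 2 ≤ l → l ≤ s.card → aeval v (elemSymm s l) = 0) ↔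
      ∀ x ∈ s, ∀ y ∈ s, v x ≠ 0 → v y ≠ 0 → x = y := by
  classical
  constructor
  · intro h x hx y hy hvx hvy
    by_contra hne
    let N := s.filter fun z => v z ≠ 0
    have hN : 2 ≤ N.card := by
      rw [← Finset.card_pair hne]
      refine Finset.card_le_card fun z hz => ?_
      rcases Finset.mem_insert.1 hz with rfl | hz
      · exact Finset.mem_filter.2 ⟨hx, hvx⟩
      · rw [Finset.mem_singleton.1 hz]
        exact Finset.mem_filter.2 ⟨hy, hvy⟩
    have h1 := h N.card hN (Finset.card_le_card (Finset.filter_subset _ _))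
    rw [aeval_elemSymm, Finset.sum_eq_single N] at h1
    · exact Finset.prod_ne_zero_iff.2 (fun z hz => (Finset.mem_filter.1 hz).2) h1
    · intro t ht hne
      obtain ⟨hts, htc⟩ := Finset.mem_powersetCard.1 ht
      by_contra hprod
      refine hne (Finset.eq_of_subset_of_card_le (fun z hz => ?_) htc.ge)
      exact Finset.mem_filter.2 ⟨hts hz, Finset.prod_ne_zero_iff.1 hprod z hz⟩
    · intro hN'
      exact absurd (Finset.mem_powersetCard.2 ⟨Finset.filter_subset _ _, rfl⟩) hN'
  · intro h l hl _
    rw [aeval_elemSymm]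
    refine Finset.sum_eq_zero fun t ht => ?_
    obtain ⟨hts, htc⟩ := Finset.mem_powersetCard.1 ht
    by_contra hprod
    replace hprod := Finset.prod_ne_zero_iff.1 hprod
    obtain ⟨x, hx, y, hy, hne⟩ := Finset.one_lt_card.1 (by omega : 1 < t.card)
    exact hne (h x (hts hx) y (hts hy) (hprod x hx) (hprod y hy))

end ElementarySymmetric

/-! ### Edge weights that come from weights on cycles. -/

section Incidence

variable [Fintype E]

noncomputable instance fintypeDirectedCycle : Fintype G.DirectedCycle := Fintype.ofFinite _

variable (G) in
open Classical in
/-- The linear map that sends a weight on the directed cycles to the sum of the weighted indicator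
functions of the cycles. -/
noncomputable def cycleMap : (G.DirectedCycle → ℂ) →ₗ[ℂ] (E → ℂ) where
  toFun y e := ∑ C, if e ∈ C.1 then y C else 0
  map_add' y z := by
    funext e
    simp only [Pi.add_apply, ← Finset.sum_add_distrib]
    refine Finset.sum_congr rfl fun C _ => ?_
    split_ifs <;> simp
  map_smul' a y := by
    funext e
    simp only [Pi.smul_apply, Finset.smul_sum, RingHom.id_apply]
    refine Finset.sum_congr rfl fun C _ => ?_
    split_ifs <;> simp

/-- The restriction of the cycle map to the weights on a collection of cycles. -/
noncomputable def packingMap (𝒞 : Finset G.DirectedCycle) : (𝒞 → ℂ) →ₗ[ℂ] (E → ℂ) :=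
  G.cycleMap ∘ₗ Function.ExtendByZero.linearMap ℂ Subtype.val

theorem cycleMap_apply_of_mem {𝒞 : Finset G.DirectedCycle} (h𝒞 : G.PairwiseDisjointCycles 𝒞)
    {y : G.DirectedCycle → ℂ} (hy : ∀ C, C ∉ 𝒞 → y C = 0) {C : G.DirectedCycle} (hC : C ∈ 𝒞)
    {e : E} (he : e ∈ C.1) : G.cycleMap y e = y C := by
  classical
  change (∑ C, if e ∈ C.1 then y C else 0) = y C
  rw [Finset.sum_eq_single C, if_pos he]
  · intro D _ hne
    split_ifs with heD
    · by_cases hD : D ∈ 𝒞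
      · exact absurd (h𝒞.eq_of_mem hD hC heD he) hne
      · exact hy D hD
    · rfl
  · intro h
    exact absurd (Finset.mem_univ C) h

theorem cycleMap_apply_of_notMem {𝒞 : Finset G.DirectedCycle}
    {y : G.DirectedCycle → ℂ} (hy : ∀ C, C ∉ 𝒞 → y C = 0) {e : E} (he : e ∉ edgeSet 𝒞) :
    G.cycleMap y e = 0 := by
  classical
  change (∑ C, if e ∈ C.1 then y C else 0) = 0
  refine Finset.sum_eq_zero fun C _ => ?_
  split_ifs with heC
  · exact hy C fun hC => he ⟨C, hC, heC⟩
  · rfl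

theorem mem_range_packingMap {𝒞 : Finset G.DirectedCycle} {v : E → ℂ} :
    v ∈ LinearMap.range (packingMap 𝒞) ↔
      ∃ y : G.DirectedCycle → ℂ, (∀ C, C ∉ 𝒞 → y C = 0) ∧ G.cycleMap y = v := by
  constructor
  · rintro ⟨y, rfl⟩
    refine ⟨Function.extend Subtype.val y 0, fun C hC => ?_, rfl⟩
    rw [Function.extend_apply' _ _ _ (by rintro ⟨D, rfl⟩; exact hC D.2)]
    rfl
  · rintro ⟨y, hy, rfl⟩
    refine ⟨fun C => y C, ?_⟩
    change G.cycleMap (Function.extend Subtype.val (fun C : 𝒞 => y C) 0) = _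
    congr 1
    funext C
    by_cases hC : C ∈ 𝒞
    · exact Subtype.val_injective.extend_apply _ _ (⟨C, hC⟩ : 𝒞)
    · rw [Function.extend_apply' _ _ _ (by rintro ⟨D, rfl⟩; exact hC D.2), hy C hC]
      rfl

theorem packingMap_injective {𝒞 : Finset G.DirectedCycle} (h𝒞 : G.PairwiseDisjointCycles 𝒞) :
    Function.Injective (packingMap 𝒞) := by
  rw [injective_iff_map_eq_zero]
  intro y hy
  funext C
  obtain ⟨e, he⟩ := C.1.exists_mem
  have h := cycleMap_apply_of_mem h𝒞 (y := Function.extend Subtype.val y 0) (fun D hD => by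
    rw [Function.extend_apply' _ _ _ (by rintro ⟨D, rfl⟩; exact hD D.2)]
    rfl) C.2 he
  rw [Subtype.val_injective.extend_apply] at h
  rw [← h]
  exact congrFun hy e

/-- The vector with weight 1 on each cycle of `𝒞` is nonzero on every edge of `𝒞`. If it comes from
`𝒟`, these edges belong to `𝒟`, and a cycle made of edges of a packing is a member of that packing.
-/
theorem range_packingMap_le_iff {𝒞 𝒟 : Finset G.DirectedCycle}
    (h𝒞 : G.PairwiseDisjointCycles 𝒞) (h𝒟 : G.PairwiseDisjointCycles 𝒟) :
    LinearMap.range (packingMap 𝒞) ≤ LinearMap.range (packingMap 𝒟) ↔ 𝒞 ⊆ 𝒟 := by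
  classical
  constructor
  · intro h
    refine h𝒟.subset_of_edgeSet_subset fun e he => ?_
    by_contra hne
    let y : G.DirectedCycle → ℂ := fun C => if C ∈ 𝒞 then 1 else 0
    have hy : ∀ C, C ∉ 𝒞 → y C = 0 := fun C hC => if_neg hC
    obtain ⟨z, hz, hzy⟩ := mem_range_packingMap.1 (h (mem_range_packingMap.2 ⟨y, hy, rfl⟩))
    obtain ⟨C, hC, heC⟩ := he
    have h1 := cycleMap_apply_of_mem h𝒞 hy hC heC
    rw [← hzy, cycleMap_apply_of_notMem hz hne] at h1
    simp [y, hC] at h1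
  · intro h v hv
    obtain ⟨y, hy, rfl⟩ := mem_range_packingMap.1 hv
    exact mem_range_packingMap.2 ⟨y, fun C hC => hy C fun hC' => hC (h hC'), rfl⟩

/-! ### Solutions of the strong incidence relations -/

theorem mem_outEdges {v : V} {e : E} : e ∈ G.outEdges v ↔ G.init e = v := by
  simp [outEdges]

theorem mem_inEdges {v : V} {e : E} : e ∈ G.inEdges v ↔ G.term e = v := by
  simp [inEdges]

theorem forall_mem_strongIncidenceIdeal_iff (v : E → ℂ) :
    (∀ f ∈ G.strongIncidenceIdeal, aeval v f = 0) ↔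
      (∀ w, ∑ x ∈ G.outEdges w, v x = ∑ x ∈ G.inEdges w, v x) ∧
        Set.InjOn G.init {e | v e ≠ 0} ∧ Set.InjOn G.term {e | v e ≠ 0} := by
  have h1 : (∀ f ∈ G.strongIncidenceIdeal, aeval v f = 0) ↔
      ∀ w, ∀ f ∈ G.strongRelationsAt w, aeval v f = 0 := by
    constructor
    · intro h w f hf
      exact h f (Ideal.subset_span (Set.mem_iUnion.2 ⟨w, hf⟩))
    · intro h f hf
      have hle : G.strongIncidenceIdeal ≤ RingHom.ker (aeval (R := ℤ) v) := by
        refine Ideal.span_le.2 fun f hf => ?_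
        obtain ⟨w, hw⟩ := Set.mem_iUnion.1 hf
        exact h w f hw
      exact hle hf
  have h2 : ∀ w, (∀ f ∈ G.strongRelationsAt w, aeval v f = 0) ↔
      (∑ x ∈ G.outEdges w, v x = ∑ x ∈ G.inEdges w, v x) ∧
        (∀ x ∈ G.outEdges w, ∀ y ∈ G.outEdges w, v x ≠ 0 → v y ≠ 0 → x = y) ∧
        (∀ x ∈ G.inEdges w, ∀ y ∈ G.inEdges w, v x ≠ 0 → v y ≠ 0 → x = y) := by
    intro w
    rw [← forall_aeval_elemSymm_eq_zero_iff, ← forall_aeval_elemSymm_eq_zero_iff, ← sub_eq_zero,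
      ← aeval_elemSymm_one, ← aeval_elemSymm_one, ← map_sub]
    constructor
    · intro h
      exact ⟨h _ (Or.inl (Or.inl rfl)), fun l h2 hl => h _ (Or.inl (Or.inr ⟨l, h2, hl, rfl⟩)),
        fun l h2 hl => h _ (Or.inr ⟨l, h2, hl, rfl⟩)⟩
    · rintro ⟨ha, hb, hc⟩ f ((rfl | ⟨l, h2, hl, rfl⟩) | ⟨l, h2, hl, rfl⟩)
      · exact ha
      · exact hb l h2 hl
      · exact hc l h2 hl
  simp only [h1, h2, mem_outEdges, mem_inEdges, forall_and]
  refine and_congr_right fun _ => and_congr ?_ ?_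
  · exact ⟨fun h x hx y hy hxy => h (G.init y) x hxy y rfl hx hy,
      fun h w x hx y hy hvx hvy => h hvx hvy (hx.trans hy.symm)⟩
  · exact ⟨fun h x hx y hy hxy => h (G.term y) x hxy y rfl hx hy,
      fun h w x hx y hy hvx hvy => h hvx hvy (hx.trans hy.symm)⟩

theorem sum_outEdges_eq {v : E → ℂ} (h : Set.InjOn G.init {e | v e ≠ 0}) {e : E}
    (he : v e ≠ 0) : ∑ x ∈ G.outEdges (G.init e), v x = v e := by
  rw [Finset.sum_eq_single e]
  · intro x hx hne
    by_contra hvx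
    exact hne (h hvx he (mem_outEdges.1 hx))
  · intro h
    exact absurd (mem_outEdges.2 rfl) h

theorem sum_inEdges_eq {v : E → ℂ} (h : Set.InjOn G.term {e | v e ≠ 0}) {e : E}
    (he : v e ≠ 0) : ∑ x ∈ G.inEdges (G.term e), v x = v e := by
  rw [Finset.sum_eq_single e]
  · intro x hx hne
    by_contra hvx
    exact hne (h hvx he (mem_inEdges.1 hx))
  · intro h
    exact absurd (mem_inEdges.2 rfl) h

/-- The inflow at the end of a support edge is its own weight, which is nonzero. So some support
edge leaves there, with the same weight. The support therefore splits into disjoint cycles along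
which `v` is constant. -/
theorem exists_mem_range_packingMap {v : E → ℂ}
    (hsum : ∀ w, ∑ x ∈ G.outEdges w, v x = ∑ x ∈ G.inEdges w, v x)
    (hinit : Set.InjOn G.init {e | v e ≠ 0}) (hterm : Set.InjOn G.term {e | v e ≠ 0}) :
    ∃ 𝒞 : Finset G.DirectedCycle, G.PairwiseDisjointCycles 𝒞 ∧
      v ∈ LinearMap.range (packingMap 𝒞) := by
  classical
  have hv : ∀ x y, v x ≠ 0 → v y ≠ 0 → G.term x = G.init y → v x = v y := by
    intro x y hx hy hxy
    rw [← sum_inEdges_eq hterm hx, hxy, ← hsum, sum_outEdges_eq hinit hy]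
  obtain ⟨𝒞, h𝒞, hS⟩ := exists_pairwiseDisjointCycles_edgeSet_eq hinit hterm (by
    intro x hx
    have h1 := sum_inEdges_eq hterm hx
    rw [← hsum] at h1
    obtain ⟨y, hy, hvy⟩ := Finset.exists_ne_zero_of_sum_ne_zero (h1.trans_ne hx)
    exact ⟨y, hvy, (mem_outEdges.1 hy).symm⟩)
  refine ⟨𝒞, h𝒞, mem_range_packingMap.2
    ⟨fun C => if C ∈ 𝒞 then v C.exists_mem.choose else 0, fun C hC => if_neg hC, ?_⟩⟩
  have hconst : ∀ C ∈ 𝒞, ∀ x ∈ C.1, ∀ y ∈ C.1, v x = v y := by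
    intro C hC x hx y hy
    have hmem : ∀ z ∈ C.1, v z ≠ 0 := fun z hz => hS.subset ⟨C, hC, hz⟩
    have hchain : (C.1.map v).Chain Eq := by
      rw [Cycle.chain_map]
      exact C.2.2.1.imp_of_mem fun x hx y hy hxy => hv x y (hmem x hx) (hmem y hy) hxy
    exact Cycle.chain_iff_pairwise.1 hchain _ (Cycle.mem_map.2 ⟨x, hx, rfl⟩) _
      (Cycle.mem_map.2 ⟨y, hy, rfl⟩)
  funext e
  by_cases he : e ∈ edgeSet 𝒞
  · obtain ⟨C, hC, heC⟩ := he
    rw [cycleMap_apply_of_mem h𝒞 (fun C hC => if_neg hC) hC heC, if_pos hC]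
    exact hconst C hC _ C.exists_mem.choose_spec _ heC
  · rw [cycleMap_apply_of_notMem (𝒞 := 𝒞) (fun C hC => if_neg hC) he]
    rw [hS] at he
    exact (not_not.1 he).symm

theorem incidence_of_mem_range_packingMap {𝒞 : Finset G.DirectedCycle}
    (h𝒞 : G.PairwiseDisjointCycles 𝒞) {v : E → ℂ} (hv : v ∈ LinearMap.range (packingMap 𝒞)) :
    (∀ w, ∑ x ∈ G.outEdges w, v x = ∑ x ∈ G.inEdges w, v x) ∧
      Set.InjOn G.init {e | v e ≠ 0} ∧ Set.InjOn G.term {e | v e ≠ 0} := by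
  obtain ⟨y, hy, rfl⟩ := mem_range_packingMap.1 hv
  have hsub : {e | G.cycleMap y e ≠ 0} ⊆ edgeSet 𝒞 := fun e he => by
    by_contra hne
    exact he (cycleMap_apply_of_notMem hy hne)
  have hinit : Set.InjOn G.init {e | G.cycleMap y e ≠ 0} := fun a ha b hb hab =>
    h𝒞.eq_of_init_eq (hsub ha) (hsub hb) hab
  have hterm : Set.InjOn G.term {e | G.cycleMap y e ≠ 0} := fun a ha b hb hab =>
    h𝒞.eq_of_term_eq (hsub ha) (hsub hb) hab
  refine ⟨fun w => ?_, hinit, hterm⟩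
  -- A vertex touched by the support lies on a single cycle of the packing, and both sums equal the
  -- weight of that cycle. At any other vertex both sums are zero.
  by_cases hw : ∃ e, G.cycleMap y e ≠ 0 ∧ (G.init e = w ∨ G.term e = w)
  · obtain ⟨e, he, hew⟩ := hw
    obtain ⟨C, hC, heC⟩ := hsub he
    have hval : ∀ x ∈ C.1, G.cycleMap y x = y C := fun x hx =>
      cycleMap_apply_of_mem h𝒞 hy hC hx
    have hne : ∀ x ∈ C.1, G.cycleMap y x ≠ 0 := fun x hx => by
      rw [hval x hx, ← hval e heC]
      exact he
    rcases hew with rfl | rfl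
    · obtain ⟨f, hf, hfe⟩ := DirectedCycle.exists_prev heC
      rw [sum_outEdges_eq hinit he, ← hfe, sum_inEdges_eq hterm (hne f hf), hval e heC, hval f hf]
    · obtain ⟨f, hf, hfe⟩ := DirectedCycle.exists_next heC
      rw [sum_inEdges_eq hterm he, hfe, sum_outEdges_eq hinit (hne f hf), hval e heC, hval f hf]
  · push Not at hw
    rw [Finset.sum_eq_zero, Finset.sum_eq_zero]
    · intro x hx
      by_contra hne
      exact (hw x hne).2 (mem_inEdges.1 hx)
    · intro x hx
      by_contra hne
      exact (hw x hne).1 (mem_outEdges.1 hx)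

theorem forall_mem_strongIncidenceIdeal_iff_exists (v : E → ℂ) :
    (∀ f ∈ G.strongIncidenceIdeal, aeval v f = 0) ↔
      ∃ 𝒞 : Finset G.DirectedCycle, G.PairwiseDisjointCycles 𝒞 ∧
        v ∈ LinearMap.range (packingMap 𝒞) := by
  rw [forall_mem_strongIncidenceIdeal_iff]
  constructor
  · rintro ⟨h1, h2, h3⟩
    exact exists_mem_range_packingMap h1 h2 h3
  · rintro ⟨𝒞, h𝒞, hv⟩
    exact incidence_of_mem_range_packingMap h𝒞 hv

/-- Elements of the ideal need not be homogeneous, so vanishing at a point involves all nonzero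
multiples of `v`. They are solutions too, because the solutions form a union of subspaces. -/
theorem mk_mem_strongIncidenceSet_iff (v : E → ℂ) (hv : v ≠ 0) :
    Projectivization.mk ℂ v hv ∈ G.strongIncidenceSet ↔
      ∃ 𝒞 : Finset G.DirectedCycle, G.PairwiseDisjointCycles 𝒞 ∧
        v ∈ LinearMap.range (packingMap 𝒞) := by
  rw [← forall_mem_strongIncidenceIdeal_iff_exists]
  constructor
  · intro h f hf
    exact h f hf v hv rfl
  · intro h f hf
    rw [CProj.vanishes_mk_iff]
    intro a _
    obtain ⟨𝒞, h𝒞, hv⟩ := (forall_mem_strongIncidenceIdeal_iff_exists v).1 h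
    exact (forall_mem_strongIncidenceIdeal_iff_exists (a • v)).2
      ⟨𝒞, h𝒞, Submodule.smul_mem _ a hv⟩ f hf

end Incidence

end DirectedGraph

/-! ### Finite closed covers: irreducible subsets and dimension. -/

theorem Topology.IsInducing.isPreirreducible_of_image {X Y : Type*} [TopologicalSpace X]
    [TopologicalSpace Y] {f : Y → X} (hf : Topology.IsInducing f) {s : Set Y}
    (hs : IsPreirreducible (f '' s)) : IsPreirreducible s := by
  intro U V hU hV hsU hsV
  obtain ⟨U, hU', rfl⟩ := hf.isOpen_iff.1 hU
  obtain ⟨V, hV', rfl⟩ := hf.isOpen_iff.1 hV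
  obtain ⟨y, hy, hyU⟩ := hsU
  obtain ⟨z, hz, hzV⟩ := hsV
  obtain ⟨_, ⟨w, hw, rfl⟩, hwUV⟩ := hs U V hU' hV' ⟨f y, ⟨y, hy, rfl⟩, hyU⟩ ⟨f z, ⟨z, hz, rfl⟩, hzV⟩
  exact ⟨w, hw, hwUV⟩

theorem IsIrreducible.exists_subset_of_iUnion_eq_univ {X ι : Type*} [TopologicalSpace X]
    [Finite ι] {Z : ι → Set X} (hZ : ∀ i, IsClosed (Z i)) (hcover : ⋃ i, Z i = Set.univ)
    {s : Set X} (hs : IsIrreducible s) : ∃ i, s ⊆ Z i := by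
  classical
  have := Fintype.ofFinite ι
  obtain ⟨z, hz, hsz⟩ := isIrreducible_iff_sUnion_isClosed.1 hs (Finset.univ.image Z)
    (by
      intro z hz
      obtain ⟨i, -, rfl⟩ := Finset.mem_image.1 hz
      exact hZ i)
    (by simp [hcover])
  obtain ⟨i, -, rfl⟩ := Finset.mem_image.1 hz
  exact ⟨i, hsz⟩

/-- The largest member of a chain is irreducible and hence lies in one piece of the cover. The whole
chain then pulls back to that piece. -/
theorem topologicalKrullDim_le_of_iUnion_range_eq_univ {X ι : Type*} [TopologicalSpace X]
    [Finite ι] {Y : ι → Type*} [∀ i, TopologicalSpace (Y i)] {f : ∀ i, Y i → X}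
    (hf : ∀ i, Topology.IsClosedEmbedding (f i)) (hcover : ⋃ i, Set.range (f i) = Set.univ)
    {d : WithBot ℕ∞} (hd : ∀ i, topologicalKrullDim (Y i) ≤ d) : topologicalKrullDim X ≤ d := by
  refine iSup_le fun p => ?_
  obtain ⟨i, hi⟩ := p.last.isIrreducible.exists_subset_of_iUnion_eq_univ
    (fun i => (hf i).isClosed_range) hcover
  have himg : ∀ j, f i '' (f i ⁻¹' (p j : Set X)) = p j := fun j =>
    Set.image_preimage_eq_of_subset (Set.Subset.trans (p.monotone (Fin.le_last j)) hi)
  let q : LTSeries (TopologicalSpace.IrreducibleCloseds (Y i)) :=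
    { length := p.length
      toFun := fun j =>
        { carrier := f i ⁻¹' p j
          isIrreducible' := by
            refine ⟨?_, (hf i).isInducing.isPreirreducible_of_image ?_⟩
            · rw [← Set.image_nonempty (f := f i), himg]
              exact (p j).isIrreducible.nonempty
            · rw [himg]
              exact (p j).isIrreducible.isPreirreducible
          isClosed' := (p j).isClosed.preimage (hf i).continuous }
      step := by
        intro j
        have hj : p j.castSucc < p j.succ := p.step j
        refine lt_of_le_of_ne (Set.preimage_mono hj.le) fun h => hj.ne ?_
        apply SetLike.coe_injective
        have h' : f i ⁻¹' (p j.castSucc : Set X) = f i ⁻¹' (p j.succ : Set X) :=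
          h
        rw [← himg, h', himg] }
  exact (Order.LTSeries.length_le_krullDim q).trans (hd i)

/-! ### Uniqueness of the dimension, with the empty space included. -/

namespace CProj

theorem HasDim.unique {Z : Type*} [TopologicalSpace Z] {d e : ℤ} (hd : HasDim Z d)
    (he : HasDim Z e) : d = e := by
  have hempty : IsEmpty Z → ∀ r : ℕ, topologicalKrullDim Z ≠ r := by
    intro h r hr
    have : IsEmpty (TopologicalSpace.IrreducibleCloseds Z) :=
      ⟨fun W => h.elim W.isIrreducible.nonempty.some⟩
    rw [topologicalKrullDim, Order.krullDim_eq_bot] at hr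
    exact WithBot.bot_ne_coe hr
  rcases hd with ⟨h1, rfl⟩ | ⟨r, rfl, hr⟩ <;> rcases he with ⟨h2, rfl⟩ | ⟨s, rfl, hs⟩
  · rfl
  · exact absurd hs (hempty h1 s)
  · exact absurd hr (hempty h2 r)
  · rw [hr] at hs
    exact_mod_cast hs

theorem HasDim.of_homeomorph {Y Z : Type*} [TopologicalSpace Y] [TopologicalSpace Z]
    (e : Y ≃ₜ Z) {d : ℤ} (h : HasDim Y d) : HasDim Z d := by
  rcases h with ⟨h1, h2⟩ | ⟨r, hr, h⟩
  · exact Or.inl ⟨e.symm.toEquiv.isEmpty, h2⟩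
  · exact Or.inr ⟨r, hr, by rw [← h, e.isHomeomorph.topologicalKrullDim_eq]⟩

theorem isEmpty_of_isEmpty {σ : Type*} [IsEmpty σ] : IsEmpty (CProj σ) :=
  ⟨fun p => p.rep_nonzero (Subsingleton.elim _ _)⟩

theorem hasDim {σ : Type*} [Fintype σ] : HasDim (CProj σ) ((Fintype.card σ : ℤ) - 1) := by
  rcases Nat.eq_zero_or_eq_succ_pred (Fintype.card σ) with h | h
  · have := Fintype.card_eq_zero_iff.1 h
    exact Or.inl ⟨isEmpty_of_isEmpty, by rw [h]; rfl⟩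
  · refine Or.inr ⟨_, ?_, topologicalKrullDim_eq h⟩
    rw [h]
    push_cast
    simp

end CProj

/-! ### The incidence set as a union of projective subspaces; its components and dimension. -/

namespace DirectedGraph

variable {V E : Type*} [Fintype E] {G : DirectedGraph V E}

variable (G) in
/-- The collections of pairwise disjoint directed cycles. -/
abbrev Packing : Type _ := {𝒞 : Finset G.DirectedCycle // G.PairwiseDisjointCycles 𝒞}

namespace Packing

/-- The embedding of the projective space on a packing of cycles into the ambient projective
space. -/
noncomputable def embedding (𝒜 : G.Packing) : CProj 𝒜.1 → CProj E :=
  Projectivization.map (packingMap 𝒜.1) (packingMap_injective 𝒜.2)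

theorem isClosedEmbedding_embedding (𝒜 : G.Packing) :
    Topology.IsClosedEmbedding 𝒜.embedding := CProj.isClosedEmbedding_map _

theorem mk_mem_range_embedding_iff (𝒜 : G.Packing) (v : E → ℂ) (hv : v ≠ 0) :
    Projectivization.mk ℂ v hv ∈ Set.range 𝒜.embedding ↔
      v ∈ LinearMap.range (packingMap 𝒜.1) :=
  CProj.mk_mem_range_map_iff _ v hv

theorem range_embedding_subset_iff {𝒜 ℬ : G.Packing} :
    Set.range 𝒜.embedding ⊆ Set.range ℬ.embedding ↔ 𝒜.1 ⊆ ℬ.1 := by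
  rw [← range_packingMap_le_iff 𝒜.2 ℬ.2]
  constructor
  · intro h v hv
    by_cases hv0 : v = 0
    · rw [hv0]
      exact Submodule.zero_mem _
    · exact (ℬ.mk_mem_range_embedding_iff v hv0).1
        (h ((𝒜.mk_mem_range_embedding_iff v hv0).2 hv))
  · intro h p hp
    induction p using Projectivization.ind with
    | h v hv =>
      rw [mk_mem_range_embedding_iff] at hp ⊢
      exact h hp

theorem strongIncidenceSet_eq_iUnion :
    G.strongIncidenceSet = ⋃ 𝒜 : G.Packing, Set.range 𝒜.embedding := by
  ext p
  induction p using Projectivization.ind with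
  | h v hv =>
    simp only [mk_mem_strongIncidenceSet_iff, Set.mem_iUnion, mk_mem_range_embedding_iff]
    exact ⟨fun ⟨𝒞, h𝒞, h⟩ => ⟨⟨𝒞, h𝒞⟩, h⟩, fun ⟨𝒜, h⟩ => ⟨𝒜.1, 𝒜.2, h⟩⟩

theorem range_embedding_subset (𝒜 : G.Packing) :
    Set.range 𝒜.embedding ⊆ G.strongIncidenceSet := by
  rw [strongIncidenceSet_eq_iUnion]
  exact Set.subset_iUnion (fun 𝒜 : G.Packing => Set.range 𝒜.embedding) 𝒜

/-- The embedding of the projective space on a packing of cycles into the strong incidence set. -/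
noncomputable def toSet (𝒜 : G.Packing) : CProj 𝒜.1 → G.strongIncidenceSet :=
  fun p => ⟨𝒜.embedding p, 𝒜.range_embedding_subset ⟨p, rfl⟩⟩

theorem isClosedEmbedding_toSet (𝒜 : G.Packing) : Topology.IsClosedEmbedding 𝒜.toSet := by
  refine ⟨𝒜.isClosedEmbedding_embedding.isEmbedding.codRestrict _ _, ?_⟩
  convert! 𝒜.isClosedEmbedding_embedding.isClosed_range.preimage
    (continuous_subtype_val : Continuous (Subtype.val : G.strongIncidenceSet → CProj E))
  ext p
  exact ⟨fun ⟨q, hq⟩ => ⟨q, congrArg Subtype.val hq⟩, fun ⟨q, hq⟩ => ⟨q, Subtype.ext hq⟩⟩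

theorem iUnion_range_toSet : ⋃ 𝒜 : G.Packing, Set.range 𝒜.toSet = Set.univ := by
  rw [Set.eq_univ_iff_forall]
  rintro ⟨p, hp⟩
  have h := hp
  rw [strongIncidenceSet_eq_iUnion] at h
  obtain ⟨𝒜, q, hq⟩ := Set.mem_iUnion.1 h
  exact Set.mem_iUnion.2 ⟨𝒜, q, Subtype.ext hq⟩

theorem range_toSet_subset_iff {𝒜 ℬ : G.Packing} :
    Set.range 𝒜.toSet ⊆ Set.range ℬ.toSet ↔ 𝒜.1 ⊆ ℬ.1 := by
  rw [← range_embedding_subset_iff]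
  constructor
  · rintro h _ ⟨p, rfl⟩
    obtain ⟨q, hq⟩ := h ⟨p, rfl⟩
    exact ⟨q, congrArg Subtype.val hq⟩
  · rintro h _ ⟨p, rfl⟩
    obtain ⟨q, hq⟩ := h ⟨p, rfl⟩
    exact ⟨q, Subtype.ext hq⟩

theorem isIrreducible_range_toSet {𝒜 : G.Packing} (h : 𝒜.1.Nonempty) :
    IsIrreducible (Set.range 𝒜.toSet) := by
  have : Nonempty 𝒜.1 := h.to_subtype
  rw [← Set.image_univ]
  exact (IrreducibleSpace.isIrreducible_univ _).image _
    𝒜.isClosedEmbedding_toSet.continuous.continuousOn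

theorem hasDim_range_toSet (𝒜 : G.Packing) :
    CProj.HasDim (Set.range 𝒜.toSet) ((𝒜.1.card : ℤ) - 1) := by
  have h := CProj.hasDim (σ := 𝒜.1)
  rw [Fintype.card_coe] at h
  exact h.of_homeomorph 𝒜.isClosedEmbedding_toSet.isEmbedding.toHomeomorph

theorem nonempty_of_mem_range_toSet {𝒜 : G.Packing} {p : G.strongIncidenceSet}
    (hp : p ∈ Set.range 𝒜.toSet) : 𝒜.1.Nonempty := by
  obtain ⟨q, -⟩ := hp
  by_contra h
  have : IsEmpty 𝒜.1 := Finset.isEmpty_coe_sort.2 (Finset.not_nonempty_iff_eq_empty.1 h)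
  exact CProj.isEmpty_of_isEmpty.elim q

theorem exists_stronglyMaximal (𝒜 : G.Packing) :
    ∃ ℬ : G.Packing, 𝒜.1 ⊆ ℬ.1 ∧ G.StronglyMaximal ℬ.1 := by
  obtain ⟨𝒟, h, hmax⟩ := Finite.exists_le_maximal 𝒜.2
  exact ⟨⟨𝒟, hmax.prop⟩, h, hmax⟩

theorem exists_subset_range_toSet {s : Set G.strongIncidenceSet} (hs : IsIrreducible s) :
    ∃ 𝒜 : G.Packing, s ⊆ Set.range 𝒜.toSet :=
  hs.exists_subset_of_iUnion_eq_univ (fun 𝒜 => 𝒜.isClosedEmbedding_toSet.isClosed_range)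
    iUnion_range_toSet

/-- A larger irreducible set lies in the subspace of some packing `ℬ`. Then `𝒜 ⊆ ℬ`, and maximality
of `𝒜` gives equality. -/
theorem range_toSet_mem_irreducibleComponents {𝒜 : G.Packing} (h : 𝒜.1.Nonempty)
    (hmax : G.StronglyMaximal 𝒜.1) :
    Set.range 𝒜.toSet ∈ irreducibleComponents G.strongIncidenceSet := by
  refine ⟨isIrreducible_range_toSet h, fun t ht hle => ?_⟩
  obtain ⟨ℬ, hℬ⟩ := exists_subset_range_toSet ht
  exact hℬ.trans (range_toSet_subset_iff.2
    (hmax.2 ℬ.2 (range_toSet_subset_iff.1 (Set.Subset.trans hle hℬ))))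

/-- A component lies in the subspace of some packing, which can be enlarged to a strongly maximal
one. That subspace is irreducible, so it equals the component. -/
theorem exists_of_mem_irreducibleComponents {s : Set G.strongIncidenceSet}
    (hs : s ∈ irreducibleComponents G.strongIncidenceSet) :
    ∃ 𝒜 : G.Packing, G.StronglyMaximal 𝒜.1 ∧ Set.range 𝒜.toSet = s := by
  obtain ⟨𝒜, h𝒜⟩ := exists_subset_range_toSet hs.1
  obtain ⟨ℬ, hle, hmax⟩ := 𝒜.exists_stronglyMaximal
  have hsℬ : s ⊆ Set.range ℬ.toSet := h𝒜.trans (range_toSet_subset_iff.2 hle)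
  obtain ⟨p, hp⟩ := hs.1.nonempty
  exact ⟨ℬ, hmax, Set.Subset.antisymm
    (hs.2 (isIrreducible_range_toSet (nonempty_of_mem_range_toSet (hsℬ hp))) hsℬ) hsℬ⟩

end Packing

theorem exists_subspaces_eq_strongIncidenceSet :
    ∃ S : Set (Projectivization.Subspace ℂ (E → ℂ)), S.Finite ∧
      G.strongIncidenceSet = ⋃ L ∈ S, (L : Set (CProj E)) := by
  refine ⟨Set.range fun 𝒜 : G.Packing => (LinearMap.range (packingMap 𝒜.1)).projectivization,
    Set.finite_range _, ?_⟩
  rw [Set.biUnion_range, Packing.strongIncidenceSet_eq_iUnion]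
  refine Set.iUnion_congr fun 𝒜 => ?_
  ext p
  induction p using Projectivization.ind with
  | h v hv => exact 𝒜.mk_mem_range_embedding_iff v hv

theorem encard_irreducibleComponents {n : ℕ} (hn : 1 ≤ n) :
    {Z ∈ irreducibleComponents G.strongIncidenceSet | CProj.HasDim Z ((n : ℤ) - 1)}.encard =
      (G.strongSpectrum n : ℕ∞) := by
  let T : Set G.Packing := {𝒜 | G.StronglyMaximal 𝒜.1 ∧ 𝒜.1.card = n}
  have h1 : {Z ∈ irreducibleComponents G.strongIncidenceSet | CProj.HasDim Z ((n : ℤ) - 1)} =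
      (fun 𝒜 : G.Packing => Set.range 𝒜.toSet) '' T := by
    ext s
    constructor
    · rintro ⟨hs, hdim⟩
      obtain ⟨𝒜, hmax, rfl⟩ := Packing.exists_of_mem_irreducibleComponents hs
      refine ⟨𝒜, ⟨hmax, ?_⟩, rfl⟩
      have := hdim.unique 𝒜.hasDim_range_toSet
      omega
    · rintro ⟨𝒜, ⟨hmax, hcard⟩, rfl⟩
      refine ⟨Packing.range_toSet_mem_irreducibleComponents
        -- Here `1 ≤ n` excludes the empty packing, whose projective space is empty and hence not
        -- irreducible.
        (Finset.card_pos.1 (by omega)) hmax, ?_⟩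
      rw [← hcard]
      exact 𝒜.hasDim_range_toSet
  have h2 : {𝒞 : Finset G.DirectedCycle | G.StronglyMaximal 𝒞 ∧ 𝒞.card = n} =
      Subtype.val '' T := by
    ext 𝒞
    constructor
    · rintro ⟨hmax, hcard⟩
      exact ⟨⟨𝒞, hmax.prop⟩, ⟨hmax, hcard⟩, rfl⟩
    · rintro ⟨𝒜, h, rfl⟩
      exact h
  have hinj : Set.InjOn (fun 𝒜 : G.Packing => Set.range 𝒜.toSet) T := fun 𝒜 _ ℬ _ h =>
    Subtype.ext (Finset.Subset.antisymm (Packing.range_toSet_subset_iff.1 h.subset)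
      (Packing.range_toSet_subset_iff.1 h.superset))
  rw [h1, hinj.encard_image, strongSpectrum, h2, Set.ncard_image_of_injective _
    Subtype.val_injective, (Set.toFinite T).cast_ncard_eq]

theorem isGreatest_strongPackingNumber :
    IsGreatest {k | ∃ 𝒞 : Finset G.DirectedCycle, G.PairwiseDisjointCycles 𝒞 ∧ 𝒞.card = k}
      G.strongPackingNumber := by
  have hbdd : BddAbove
      {k | ∃ 𝒞 : Finset G.DirectedCycle, G.PairwiseDisjointCycles 𝒞 ∧ 𝒞.card = k} := by
    refine ⟨Fintype.card G.DirectedCycle, ?_⟩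
    rintro _ ⟨𝒞, -, rfl⟩
    exact Finset.card_le_univ 𝒞
  refine ⟨Nat.sSup_mem ⟨0, ∅, ?_, rfl⟩ hbdd, fun k hk => le_csSup hbdd hk⟩
  intro C hC
  exact absurd hC (by simp)

theorem Packing.card_le (𝒜 : G.Packing) : 𝒜.1.card ≤ G.strongPackingNumber :=
  isGreatest_strongPackingNumber.2 ⟨𝒜.1, 𝒜.2, rfl⟩

theorem exists_packing_card_eq : ∃ 𝒜 : G.Packing, 𝒜.1.card = G.strongPackingNumber := by
  obtain ⟨𝒞, h, hc⟩ := (isGreatest_strongPackingNumber (G := G)).1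
  exact ⟨⟨𝒞, h⟩, hc⟩

theorem hasDim_strongIncidenceSet :
    CProj.HasDim G.strongIncidenceSet ((G.strongPackingNumber : ℤ) - 1) := by
  rcases Nat.eq_zero_or_eq_succ_pred G.strongPackingNumber with h | h
  · refine Or.inl ⟨⟨fun p => ?_⟩, by rw [h]; rfl⟩
    obtain ⟨𝒜, h𝒜⟩ := Set.mem_iUnion.1 (Packing.iUnion_range_toSet.superset (Set.mem_univ p))
    have h1 := Finset.card_pos.2 (Packing.nonempty_of_mem_range_toSet h𝒜)
    have h2 := 𝒜.card_le
    omega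
  · obtain ⟨𝒜, h𝒜⟩ := exists_packing_card_eq (G := G)
    set r := G.strongPackingNumber.pred
    refine Or.inr ⟨r, by rw [h]; push_cast; ring, le_antisymm ?_ ?_⟩
    · refine topologicalKrullDim_le_of_iUnion_range_eq_univ
        (fun 𝒜 : G.Packing => 𝒜.isClosedEmbedding_toSet) Packing.iUnion_range_toSet fun ℬ => ?_
      rcases Nat.eq_zero_or_eq_succ_pred ℬ.1.card with h0 | h0
      · have : IsEmpty ℬ.1 := Finset.isEmpty_coe_sort.2 (Finset.card_eq_zero.1 h0)
        have : IsEmpty (TopologicalSpace.IrreducibleCloseds (CProj ℬ.1)) :=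
          ⟨fun W => CProj.isEmpty_of_isEmpty.elim W.isIrreducible.nonempty.some⟩
        rw [topologicalKrullDim, Order.krullDim_eq_bot]
        exact bot_le
      · rw [CProj.topologicalKrullDim_eq ((Fintype.card_coe _).trans h0)]
        have := ℬ.card_le
        have h1 : ℬ.1.card.pred ≤ r := by omega
        exact_mod_cast h1
    · rw [← CProj.topologicalKrullDim_eq (((Fintype.card_coe _).trans h𝒜).trans h)]
      exact 𝒜.isClosedEmbedding_toSet.isInducing.topologicalKrullDim_le

end DirectedGraph

/-! ### Hilbert polynomials -/

section Counting

open Filter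

variable {σ : Type*}

theorem ncard_degree_eq_support_subset [DecidableEq σ] (s : Finset σ) (t : ℕ) :
    {m : σ →₀ ℕ | m.degree = t ∧ m.support ⊆ s}.ncard = s.card.multichoose t := by
  rw [← Finset.card_finsuppAntidiag_nat_eq_multichoose, ← Set.ncard_coe_finset]
  congr 1
  ext m
  simp only [Set.mem_ofPred_eq, Finset.mem_coe, Finset.mem_finsuppAntidiag]
  refine and_congr_left fun h => ?_
  rw [Finsupp.degree_apply, Finset.sum_subset h fun i _ hi => Finsupp.notMem_support_iff.1 hi]

theorem multichoose_succ_eq_eval_preHilbertPoly (r t : ℕ) :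
    ((r + 1).multichoose t : ℚ) = (Polynomial.preHilbertPoly ℚ r 0).eval (t : ℚ) := by
  rw [Polynomial.preHilbertPoly_eq_choose_sub_add ℚ r (Nat.zero_le t), Nat.multichoose_eq,
    Nat.sub_zero, show r + 1 + t - 1 = t + r by omega, Nat.choose_symm_add]

theorem exists_eventually_multichoose_eq_eval (s : ℕ) :
    ∃ P : Polynomial ℚ, ∀ᶠ t : ℕ in atTop, (s.multichoose t : ℚ) = P.eval (t : ℚ) := by
  cases s with
  | zero =>
    refine ⟨0, eventually_atTop.2 ⟨1, fun t ht => ?_⟩⟩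
    obtain ⟨t, rfl⟩ := Nat.exists_eq_add_of_le' ht
    simp
  | succ r => exact ⟨_, Eventually.of_forall (multichoose_succ_eq_eval_preHilbertPoly r)⟩

/-- The number of monomials of degree `t` that are divisible by none of the monomials in `l`. -/
noncomputable def standardCount (l : List (σ →₀ ℕ)) (t : ℕ) : ℕ :=
  {m : σ →₀ ℕ | m.degree = t ∧ ∀ g ∈ l, ¬g ≤ m}.ncard

/-- The monomials that avoid `l` are split according to divisibility by `g`. Those divisible by `g`
have the form `g + k`, and `h ≤ g + k` iff `h - g ≤ k` for truncated subtraction. -/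
theorem standardCount_cons [Finite σ] (g : σ →₀ ℕ) (l : List (σ →₀ ℕ)) {t : ℕ}
    (ht : g.degree ≤ t) :
    standardCount l t =
      standardCount (g :: l) t + standardCount (l.map fun h => h - g) (t - g.degree) := by
  have hfin : ∀ p : (σ →₀ ℕ) → Prop, {m : σ →₀ ℕ | m.degree = t ∧ p m}.Finite := fun p =>
    (Finsupp.finite_of_degree_eq t).subset fun m hm => hm.1
  have h1 : {m : σ →₀ ℕ | m.degree = t ∧ ∀ g ∈ l, ¬g ≤ m} =
      {m : σ →₀ ℕ | m.degree = t ∧ ∀ h ∈ g :: l, ¬h ≤ m} ∪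
        {m : σ →₀ ℕ | m.degree = t ∧ g ≤ m ∧ ∀ h ∈ l, ¬h ≤ m} := by
    ext m
    simp only [Set.mem_union, Set.mem_ofPred_eq, List.forall_mem_cons]
    tauto
  have h2 : {m : σ →₀ ℕ | m.degree = t ∧ g ≤ m ∧ ∀ h ∈ l, ¬h ≤ m} =
      (g + ·) '' {m : σ →₀ ℕ | m.degree = t - g.degree ∧ ∀ h ∈ l.map fun h => h - g, ¬h ≤ m} := by
    ext m
    simp only [Set.mem_image, Set.mem_ofPred_eq, List.forall_mem_map, tsub_le_iff_left]
    constructor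
    · rintro ⟨hd, hg, hl⟩
      obtain ⟨k, rfl⟩ := exists_add_of_le hg
      refine ⟨k, ⟨?_, hl⟩, rfl⟩
      rw [map_add] at hd
      omega
    · rintro ⟨k, ⟨hd, hl⟩, rfl⟩
      refine ⟨?_, le_self_add, hl⟩
      rw [map_add]
      omega
  rw [standardCount, h1, Set.ncard_union_eq _ (hfin _) (hfin _), h2,
    Set.ncard_image_of_injective _ (add_right_injective g)]
  · rfl
  · rw [Set.disjoint_left]
    intro m hm hm'
    exact hm.2 g List.mem_cons_self hm'.2.1

/-- Induction on the length of the list: the recursion expresses the count through two shorter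
lists, one of them with shifted degree. -/
theorem exists_eventually_standardCount_eq_eval [Finite σ] (l : List (σ →₀ ℕ)) :
    ∃ P : Polynomial ℚ, ∀ᶠ t : ℕ in atTop, (standardCount l t : ℚ) = P.eval (t : ℚ) := by
  classical
  have := Fintype.ofFinite σ
  induction hn : l.length generalizing l with
  | zero =>
    obtain rfl := List.length_eq_zero_iff.1 hn
    obtain ⟨P, hP⟩ := exists_eventually_multichoose_eq_eval (Finset.univ : Finset σ).card
    refine ⟨P, hP.mono fun t ht => ?_⟩
    rw [← ht, ← ncard_degree_eq_support_subset]
    simp [standardCount]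
  | succ n ih =>
    obtain ⟨g, l, rfl⟩ := List.exists_cons_of_length_eq_add_one hn
    obtain ⟨P, hP⟩ := ih l (by simpa using hn)
    obtain ⟨Q, hQ⟩ := ih (l.map fun h => h - g) (by simpa using hn)
    refine ⟨P - Q.comp (Polynomial.X - Polynomial.C (g.degree : ℚ)), ?_⟩
    filter_upwards [hP, (tendsto_sub_atTop_nat g.degree).eventually hQ,
      eventually_ge_atTop g.degree] with t h1 h2 h3
    rw [Polynomial.eval_sub, ← h1, Polynomial.eval_comp, standardCount_cons g l h3]
    simp only [Polynomial.eval_sub, Polynomial.eval_X, Polynomial.eval_C]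
    rw [← Nat.cast_sub h3, ← h2]
    push_cast
    ring

/-- By Dickson's lemma `U` has finitely many minimal elements, and these generate it. -/
theorem exists_eventually_ncard_compl_eq_eval [Finite σ] {U : Set (σ →₀ ℕ)} (hU : IsUpperSet U) :
    ∃ P : Polynomial ℚ, ∀ᶠ t : ℕ in atTop,
      ({m : σ →₀ ℕ | m.degree = t ∧ m ∉ U}.ncard : ℚ) = P.eval (t : ℚ) := by
  have hfin : {m | Minimal (· ∈ U) m}.Finite :=
    WellQuasiOrderedLE.finite_of_isAntichain (setOfPred_minimal_antichain (· ∈ U))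
  obtain ⟨P, hP⟩ := exists_eventually_standardCount_eq_eval hfin.toFinset.toList
  refine ⟨P, hP.mono fun t ht => ?_⟩
  rw [← ht, standardCount]
  congr 2
  ext m
  simp only [Set.mem_ofPred_eq, Finset.mem_toList, Set.Finite.mem_toFinset]
  refine and_congr_right fun _ => ?_
  constructor
  · intro hm g hg hgm
    exact hm (hU hgm hg.prop)
  · intro h hm
    obtain ⟨g, hgm, hg⟩ := exists_minimal_le_of_wellFoundedLT (· ∈ U) m hm
    exact h g hg hgm

end Counting

/-! ### Standard monomials and the existence of the Hilbert polynomial. -/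

namespace MvPolynomial

variable {σ K : Type*} [Field K]

theorem IsHomogeneous.degree_eq_of_mem_support {f : MvPolynomial σ K} {t : ℕ}
    (hf : f.IsHomogeneous t) {m : σ →₀ ℕ} (hm : m ∈ f.support) : m.degree = t := by
  have h := hf (mem_support_iff.1 hm)
  rw [Finsupp.degree_eq_weight_one]
  exact h

/-- The leading monomials of the forms in an ideal. -/
def initialMonomials (ord : MonomialOrder σ) (I : Ideal (MvPolynomial σ K)) : Set (σ →₀ ℕ) :=
  {m | ∃ f ∈ I, f ≠ 0 ∧ f.IsHomogeneous m.degree ∧ ord.degree f = m}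

theorem isUpperSet_initialMonomials (ord : MonomialOrder σ) (I : Ideal (MvPolynomial σ K)) :
    IsUpperSet (initialMonomials ord I) := by
  classical
  rintro m n hmn ⟨f, hf, hf0, hfh, rfl⟩
  obtain ⟨k, rfl⟩ := exists_add_of_le hmn
  have hk : (monomial k (1 : K)) ≠ 0 := by simp
  refine ⟨f * monomial k 1, I.mul_mem_right _ hf, mul_ne_zero hf0 hk, ?_, ?_⟩
  · rw [map_add]
    exact hfh.mul (isHomogeneous_monomial 1 rfl)
  · rw [ord.degree_mul hf0 hk, ord.degree_monomial, if_neg one_ne_zero]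

/-- Macaulay's theorem: the monomials of degree `t` that are not leading monomials of forms in `I`
give a basis of the quotient. Their span is a complement of the degree `t` forms in `I`. -/
theorem finrank_quotient_submoduleOf_homogeneousSubmodule [Finite σ] (ord : MonomialOrder σ)
    (I : Ideal (MvPolynomial σ K)) (t : ℕ) :
    Module.finrank K (homogeneousSubmodule σ K t ⧸
      (I.restrictScalars K).submoduleOf (homogeneousSubmodule σ K t)) =
      {m : σ →₀ ℕ | m.degree = t ∧ m ∉ initialMonomials ord I}.ncard := by
  classical
  set S := {m : σ →₀ ℕ | m.degree = t ∧ m ∉ initialMonomials ord I}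
  set H := homogeneousSubmodule σ K t
  have hSH : restrictSupport K S ≤ H := by
    rw [restrictSupport_eq_span, Submodule.span_le]
    rintro _ ⟨m, hm, rfl⟩
    exact isHomogeneous_monomial 1 hm.1
  -- Division by well-founded induction on the monomial order: modulo `I`, a leading monomial is a
  -- combination of smaller monomials of the same degree.
  have hmono : ∀ m : σ →₀ ℕ, m.degree = t → ∀ c : K,
      monomial m c ∈ restrictSupport K S ⊔ (I.restrictScalars K ⊓ H) := by
    intro m
    induction hs : ord.toSyn m using WellFoundedLT.induction generalizing m with
    | ind s ih =>
    intro hm c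
    by_cases hmI : m ∈ initialMonomials ord I
    · obtain ⟨f, hf, hf0, hfh, hfm⟩ := hmI
      rw [hm] at hfh
      have hmf : m ∈ f.support := hfm ▸ ord.degree_mem_support hf0
      have h1 : monomial m (coeff m f) +
          ∑ k ∈ f.support.erase m, monomial k (coeff k f) = f := by
        rw [Finset.add_sum_erase _ (fun k => monomial k (coeff k f)) hmf]
        exact f.support_sum_monomial_coeff
      have h2 : monomial m (coeff m f) ∈ restrictSupport K S ⊔ (I.restrictScalars K ⊓ H) := by
        rw [← eq_sub_iff_add_eq] at h1
        rw [h1]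
        refine Submodule.sub_mem _ (Submodule.mem_sup_right ⟨hf, hfh⟩)
          (Submodule.sum_mem _ fun k hk => ?_)
        obtain ⟨hkm, hkf⟩ := Finset.mem_erase.1 hk
        refine ih (ord.toSyn k) ?_ k rfl (hfh.degree_eq_of_mem_support hkf) _
        rw [← hs, ← hfm]
        refine lt_of_le_of_ne (ord.le_degree hkf) fun h => hkm ?_
        rw [ord.toSyn.injective h, hfm]
      have h3 : monomial m c = (c / coeff m f) • monomial m (coeff m f) := by
        rw [smul_monomial, smul_eq_mul, div_mul_cancel₀ _ (mem_support_iff.1 hmf)]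
      rw [h3]
      exact Submodule.smul_mem _ _ h2
    · exact Submodule.mem_sup_left ((monomial_mem_restrictSupport K).2 (Or.inl ⟨hm, hmI⟩))
  have hcompl : IsCompl ((I.restrictScalars K).submoduleOf H)
      ((restrictSupport K S).submoduleOf H) := by
    constructor
    · rw [Submodule.disjoint_def]
      rintro ⟨f, hfH⟩ hfI hfS
      replace hfI : f ∈ I := hfI
      replace hfS : f ∈ restrictSupport K S := hfS
      by_contra hf0
      replace hf0 : f ≠ 0 := fun h => hf0 (Subtype.ext h)
      have hmem := ord.degree_mem_support hf0
      refine ((mem_restrictSupport_iff K).1 hfS hmem).2 ⟨f, hfI, hf0, ?_, rfl⟩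
      rw [IsHomogeneous.degree_eq_of_mem_support hfH hmem]
      exact hfH
    · rw [codisjoint_iff, eq_top_iff]
      rintro ⟨f, hfH⟩ -
      have hf : f ∈ restrictSupport K S ⊔ (I.restrictScalars K ⊓ H) := by
        rw [← f.support_sum_monomial_coeff]
        exact Submodule.sum_mem _ fun m hm =>
          hmono m (IsHomogeneous.degree_eq_of_mem_support hfH hm) _
      obtain ⟨a, ha, b, hb, rfl⟩ := Submodule.mem_sup.1 hf
      exact Submodule.mem_sup.2 ⟨⟨b, hb.2⟩, hb.1, ⟨a, hSH ha⟩, ha, Subtype.ext (add_comm b a)⟩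
  rw [(Submodule.quotientEquivOfIsCompl _ _ hcompl).finrank_eq,
    (Submodule.submoduleOfEquivOfLe hSH).finrank_eq,
    Module.finrank_eq_nat_card_basis (basisRestrictSupport K S), Nat.card_coe_set_eq]

end MvPolynomial

theorem CProj.exists_eventually_hilbertFunction_eq_eval {E : Type*} [Finite E]
    (X : Set (CProj E)) :
    ∃ P : Polynomial ℚ, ∀ᶠ t : ℕ in Filter.atTop,
      (CProj.hilbertFunction X t : ℚ) = P.eval (t : ℚ) := by
  let : LinearOrder E := LinearOrder.lift' (Finite.equivFin E) (Finite.equivFin E).injective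
  obtain ⟨P, hP⟩ := exists_eventually_ncard_compl_eq_eval
    (MvPolynomial.isUpperSet_initialMonomials MonomialOrder.lex (vanishingIdeal X))
  refine ⟨P, hP.mono fun t ht => ?_⟩
  rw [← ht, hilbertFunction,
    MvPolynomial.finrank_quotient_submoduleOf_homogeneousSubmodule MonomialOrder.lex]

/-! ### Leading terms of polynomials and of monomial counts. -/

section Asymptotics

open Filter Topology

theorem Polynomial.natDegree_eq_and_leadingCoeff_eq_of_tendsto {P : Polynomial ℚ} {r : ℕ} {c : ℚ}
    (hc : c ≠ 0)
    (h : Tendsto (fun t : ℕ => P.eval (t : ℚ) / (t : ℚ) ^ r) atTop (𝓝 c)) :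
    P.natDegree = r ∧ P.leadingCoeff = c := by
  have hX : ∀ (Q : Polynomial ℚ) (t : ℕ), Q.eval (t : ℚ) / (t : ℚ) ^ r =
      Q.eval (t : ℚ) / (Polynomial.X ^ r : Polynomial ℚ).eval (t : ℚ) := by
    intro Q t
    simp
  simp only [hX] at h
  have hcast : Tendsto (fun t : ℕ => (t : ℚ)) atTop atTop := tendsto_natCast_atTop_atTop
  rcases lt_trichotomy P.degree (Polynomial.X ^ r : Polynomial ℚ).degree with hlt | heq | hgt
  · exact absurd (tendsto_nhds_unique h
      ((P.div_tendsto_atTop_zero_of_degree_lt _ hlt).comp hcast)) hc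
  · refine ⟨by rw [Polynomial.natDegree_eq_natDegree heq, Polynomial.natDegree_X_pow], ?_⟩
    have h1 := tendsto_nhds_unique h
      ((P.div_tendsto_atTop_leadingCoeff_div_of_degree_eq _ heq).comp hcast)
    simpa using h1.symm
  · exact absurd h.abs (not_tendsto_nhds_of_tendsto_atTop
      ((P.abs_div_tendsto_atTop_atTop_of_degree_gt _ hgt
        (pow_ne_zero _ Polynomial.X_ne_zero)).comp hcast) _)

theorem tendsto_eval_preHilbertPoly_div_pow (r k : ℕ) :
    Tendsto (fun t : ℕ => (Polynomial.preHilbertPoly ℚ r k).eval (t : ℚ) / (t : ℚ) ^ r) atTop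
      (𝓝 (r.factorial : ℚ)⁻¹) := by
  have hne : Polynomial.preHilbertPoly ℚ r k ≠ 0 := by
    rw [← Polynomial.leadingCoeff_ne_zero, Polynomial.leadingCoeff_preHilbertPoly]
    exact inv_ne_zero (Nat.cast_ne_zero.2 r.factorial_ne_zero)
  have hdeg : (Polynomial.preHilbertPoly ℚ r k).degree =
      (Polynomial.X ^ r : Polynomial ℚ).degree := by
    rw [Polynomial.degree_eq_natDegree hne, Polynomial.natDegree_preHilbertPoly,
      Polynomial.degree_X_pow]
  have h := (Polynomial.div_tendsto_atTop_leadingCoeff_div_of_degree_eq _ _ hdeg).comp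
    (tendsto_natCast_atTop_atTop (R := ℚ))
  simpa [Function.comp_def, Polynomial.leadingCoeff_preHilbertPoly] using h

/-- For `t ≥ k` the numerator is a polynomial in `t` of degree `r`. The shift by `k` leaves its
leading coefficient unchanged. -/
theorem tendsto_multichoose_sub_div_pow (r k : ℕ) :
    Tendsto (fun t : ℕ => ((r + 1).multichoose (t - k) : ℚ) / (t : ℚ) ^ r) atTop
      (𝓝 (r.factorial : ℚ)⁻¹) := by
  refine (tendsto_eval_preHilbertPoly_div_pow r k).congr' ?_
  filter_upwards [eventually_ge_atTop k] with t ht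
  rw [Polynomial.preHilbertPoly_eq_choose_sub_add ℚ r ht, Nat.multichoose_eq,
    show r + 1 + (t - k) - 1 = t - k + r by omega, Nat.choose_symm_add]

theorem tendsto_multichoose_div_pow_of_le {s r : ℕ} (h : s ≤ r) :
    Tendsto (fun t : ℕ => (s.multichoose t : ℚ) / (t : ℚ) ^ r) atTop (𝓝 0) := by
  cases s with
  | zero =>
    refine tendsto_const_nhds.congr' ?_
    filter_upwards [eventually_ge_atTop 1] with t ht
    obtain ⟨t, rfl⟩ := Nat.exists_eq_add_of_le' ht
    simp
  | succ s =>
    have h1 := (tendsto_multichoose_sub_div_pow s 0).mul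
      (((tendsto_pow_atTop (α := ℚ) (n := r - s) (by omega)).comp
        tendsto_natCast_atTop_atTop).inv_tendsto_atTop)
    rw [mul_zero] at h1
    refine h1.congr' ?_
    filter_upwards [eventually_ge_atTop 1] with t ht
    have h0 : (t : ℚ) ≠ 0 := by
      have : t ≠ 0 := by omega
      exact_mod_cast this
    simp only [Nat.sub_zero, Pi.inv_apply, Function.comp_apply]
    rw [← div_eq_mul_inv, div_div, ← pow_add, Nat.add_sub_cancel' (by omega)]

end Asymptotics

/-! ### Polynomials that vanish on coordinate subspaces. -/

namespace MvPolynomial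

variable {σ : Type*}

/-- A polynomial vanishes at the points supported on `s` if and only if the coefficients of its
monomials supported on `s` are zero. -/
theorem forall_aeval_eq_zero_iff_forall_coeff_eq_zero {s : Finset σ} {g : MvPolynomial σ ℂ} :
    (∀ y : σ → ℂ, (∀ i, i ∉ s → y i = 0) → aeval y g = 0) ↔
      ∀ m : σ →₀ ℕ, m.support ⊆ s → coeff m g = 0 := by
  classical
  have hout : ∀ (y : σ → ℂ), (∀ i, i ∉ s → y i = 0) → ∀ m : σ →₀ ℕ, ¬m.support ⊆ s →
      (m.prod fun i k => y i ^ k) = 0 := by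
    intro y hy m hm
    obtain ⟨i, hi, his⟩ := Finset.not_subset.1 hm
    refine Finset.prod_eq_zero hi ?_
    beta_reduce
    rw [hy i his, zero_pow (Finsupp.mem_support_iff.1 hi)]
  constructor
  · intro h
    -- The part of `g` supported on `s`. It does not see the coordinates outside `s`, so once it
    -- vanishes on the coordinate subspace it vanishes everywhere.
    let g' : MvPolynomial σ ℂ :=
      ∑ m ∈ g.support with m.support ⊆ s, monomial m (coeff m g)
    have hg' : g' = 0 := by
      refine MvPolynomial.funext fun y => ?_
      have h1 : ∀ y : σ → ℂ, (∀ i, i ∉ s → y i = 0) → aeval y g' = 0 := by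
        intro y hy
        rw [← h y hy]
        conv_rhs => rw [← g.support_sum_monomial_coeff]
        rw [map_sum, map_sum, Finset.sum_filter_of_ne]
        intro m _ hne
        by_contra hm
        rw [aeval_monomial, hout y hy m hm, mul_zero] at hne
        exact hne rfl
      have h2 := h1 (fun i => if i ∈ s then y i else 0) fun i hi => if_neg hi
      rw [map_zero, ← h2]
      change aeval y g' = _
      rw [map_sum, map_sum]
      refine Finset.sum_congr rfl fun m hm => ?_
      rw [aeval_monomial, aeval_monomial]
      congr 1
      refine Finset.prod_congr rfl fun i hi => ?_
      beta_reduce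
      rw [if_pos ((Finset.mem_filter.1 hm).2 hi)]
    intro m hm
    by_contra hne
    have h3 : coeff m g' = coeff m g := by
      rw [coeff_sum, Finset.sum_eq_single m]
      · rw [coeff_monomial, if_pos rfl]
      · intro k _ hk
        rw [coeff_monomial, if_neg hk]
      · intro hmem
        exact absurd (Finset.mem_filter.2 ⟨mem_support_iff.2 hne, hm⟩) hmem
    rw [hg', coeff_zero] at h3
    exact hne h3.symm
  · intro h y hy
    rw [← g.support_sum_monomial_coeff, map_sum]
    refine Finset.sum_eq_zero fun m _ => ?_
    rw [aeval_monomial]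
    by_cases hm : m.support ⊆ s
    · rw [h m hm, map_zero, zero_mul]
    · rw [hout y hy m hm, mul_zero]

end MvPolynomial

/-! ### The Hilbert function of the incidence set as a rank, with bounds. -/

namespace DirectedGraph

open MvPolynomial

variable {V E : Type*} [Fintype E] {G : DirectedGraph V E}

/-- The cone is the image under `cycleMap` of the coordinate subspaces of the packings, so vanishing
can be read from coefficients. The zero vector is no projective point, and `t ≠ 0` ensures that
forms vanish there. -/
theorem mem_vanishingIdeal_strongIncidenceSet_iff {f : MvPolynomial E ℂ} {t : ℕ} (ht : t ≠ 0)
    (hf : f.IsHomogeneous t) :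
    f ∈ CProj.vanishingIdeal G.strongIncidenceSet ↔
      ∀ m : G.DirectedCycle →₀ ℕ, G.PairwiseDisjointCycles m.support →
        coeff m (CProj.pullback G.cycleMap f) = 0 := by
  have h1 : f ∈ CProj.vanishingIdeal G.strongIncidenceSet ↔
      ∀ 𝒜 : G.Packing, ∀ y : G.DirectedCycle → ℂ, (∀ C, C ∉ 𝒜.1 → y C = 0) →
        aeval y (CProj.pullback G.cycleMap f) = 0 := by
    constructor
    · intro h 𝒜 y hy
      rw [CProj.aeval_pullback]
      by_cases h0 : G.cycleMap y = 0
      · rw [h0, ← zero_smul ℂ (0 : E → ℂ), hf.aeval_smul, zero_pow ht, zero_mul]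
      · exact h _ ((mk_mem_strongIncidenceSet_iff _ h0).2
          ⟨𝒜.1, 𝒜.2, mem_range_packingMap.2 ⟨y, hy, rfl⟩⟩) _ h0 rfl
    · intro h p hp
      induction p using Projectivization.ind with
      | h v hv =>
        rw [CProj.vanishes_mk_iff_of_isHomogeneous hf]
        obtain ⟨𝒞, h𝒞, hv'⟩ := (mk_mem_strongIncidenceSet_iff v hv).1 hp
        obtain ⟨y, hy, rfl⟩ := mem_range_packingMap.1 hv'
        rw [← CProj.aeval_pullback]
        exact h ⟨𝒞, h𝒞⟩ y hy
  rw [h1]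
  simp only [forall_aeval_eq_zero_iff_forall_coeff_eq_zero]
  exact ⟨fun h m hm => h ⟨m.support, hm⟩ m Finset.Subset.rfl,
    fun h 𝒜 m hm => h m (𝒜.2.mono hm)⟩

variable (G) in
/-- The monomials of degree `t` in the directed cycles whose support is a packing. -/
abbrev PackingMonomial (t : ℕ) : Type _ :=
  {m : G.DirectedCycle →₀ ℕ // m.degree = t ∧ G.PairwiseDisjointCycles m.support}

instance finitePackingMonomial (t : ℕ) : Finite (G.PackingMonomial t) :=
  ((Finsupp.finite_of_degree_eq t).subset fun _ hm => hm.1 :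
    {m : G.DirectedCycle →₀ ℕ | m.degree = t ∧ G.PairwiseDisjointCycles m.support}.Finite)

variable (G) in
/-- The coefficients of a form in terms of the weights of the cycles in packings. -/
noncomputable def packingCoeff (t : ℕ) :
    homogeneousSubmodule E ℂ t →ₗ[ℂ] (G.PackingMonomial t → ℂ) :=
  LinearMap.pi (fun m => lcoeff ℂ m.1) ∘ₗ (CProj.pullback G.cycleMap).toLinearMap ∘ₗ
    (homogeneousSubmodule E ℂ t).subtype

theorem ker_packingCoeff {t : ℕ} (ht : t ≠ 0) :
    LinearMap.ker (G.packingCoeff t) =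
      ((CProj.vanishingIdeal G.strongIncidenceSet).restrictScalars ℂ).submoduleOf
        (homogeneousSubmodule E ℂ t) := by
  ext ⟨f, hf⟩
  have h1 := mem_vanishingIdeal_strongIncidenceSet_iff (G := G) ht hf
  change _ ↔ f ∈ CProj.vanishingIdeal G.strongIncidenceSet
  rw [h1, LinearMap.mem_ker]
  constructor
  · intro h m hm
    by_cases hmt : m.degree = t
    · exact congrFun h ⟨m, hmt, hm⟩
    · by_contra hne
      exact hmt ((CProj.isHomogeneous_pullback G.cycleMap hf).degree_eq_of_mem_support
        (mem_support_iff.2 hne))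
  · intro h
    funext m
    exact h m.1 m.2.2

theorem hilbertFunction_strongIncidenceSet {t : ℕ} (ht : t ≠ 0) :
    CProj.hilbertFunction G.strongIncidenceSet t =
      Module.finrank ℂ (LinearMap.range (G.packingCoeff t)) := by
  rw [CProj.hilbertFunction, ← ker_packingCoeff ht]
  exact (G.packingCoeff t).quotKerEquivRange.finrank_eq

/-- The rank is at most the number of packing monomials. Counting them packing by packing repeats
only monomials whose support is not of maximum size, and these have lower order in `t`. -/
theorem hilbertFunction_strongIncidenceSet_le {t : ℕ} (ht : t ≠ 0) :
    CProj.hilbertFunction G.strongIncidenceSet t ≤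
      ∑ᶠ 𝒜 : G.Packing, 𝒜.1.card.multichoose t := by
  classical
  have := Fintype.ofFinite G.Packing
  have := Fintype.ofFinite (G.PackingMonomial t)
  rw [hilbertFunction_strongIncidenceSet ht, finsum_eq_sum_of_fintype]
  calc Module.finrank ℂ (LinearMap.range (G.packingCoeff t))
      ≤ Module.finrank ℂ (G.PackingMonomial t → ℂ) := Submodule.finrank_le _
    _ = {m : G.DirectedCycle →₀ ℕ | m.degree = t ∧ G.PairwiseDisjointCycles m.support}.ncard := by
        rw [Module.finrank_fintype_fun_eq_card, ← Nat.card_eq_fintype_card]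
        rfl
    _ ≤ (⋃ 𝒜 : G.Packing,
          {m : G.DirectedCycle →₀ ℕ | m.degree = t ∧ m.support ⊆ 𝒜.1}).ncard := by
        refine Set.ncard_le_ncard ?_ (Set.finite_iUnion fun 𝒜 =>
          (Finsupp.finite_of_degree_eq t).subset fun _ hm => hm.1)
        intro m hm
        exact Set.mem_iUnion.2 ⟨⟨m.support, hm.2⟩, hm.1, Finset.Subset.rfl⟩
    _ ≤ ∑ 𝒜 : G.Packing,
          {m : G.DirectedCycle →₀ ℕ | m.degree = t ∧ m.support ⊆ 𝒜.1}.ncard :=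
        Set.ncard_iUnion_le_of_fintype _
    _ = ∑ 𝒜 : G.Packing, 𝒜.1.card.multichoose t :=
        Finset.sum_congr rfl fun 𝒜 _ => ncard_degree_eq_support_subset 𝒜.1 t

open Classical in
/-- The set of edges of a directed cycle, as a finset. -/
noncomputable def DirectedCycle.edges (C : G.DirectedCycle) : Finset E :=
  Finset.univ.filter fun e => e ∈ C.1

theorem DirectedCycle.mem_edges {C : G.DirectedCycle} {e : E} : e ∈ C.edges ↔ e ∈ C.1 := by
  simp [edges]

/-- The monomial in the edges that contains each edge of the packing and restricts to the monomial
`m` in the cycles. -/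
noncomputable def edgeMonomial (m : G.DirectedCycle →₀ ℕ) : MvPolynomial E ℂ :=
  ∏ C ∈ m.support, (X C.exists_mem.choose ^ (m C - C.edges.card) * ∏ e ∈ C.edges, X e)

theorem isHomogeneous_edgeMonomial {m : G.DirectedCycle →₀ ℕ}
    (hm : ∀ C ∈ m.support, C.edges.card ≤ m C) : (edgeMonomial m).IsHomogeneous m.degree := by
  rw [Finsupp.degree_apply]
  refine IsHomogeneous.prod _ _ _ fun C hC => ?_
  have h := (((isHomogeneous_X ℂ C.exists_mem.choose).pow (m C - C.edges.card)).mul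
    (IsHomogeneous.prod C.edges (fun e => (X e : MvPolynomial E ℂ)) (fun _ => 1)
      fun e _ => isHomogeneous_X ℂ e))
  convert! h
  have := hm C hC
  simp
  omega

/-- If the cycles of `m` all belong to the packing, each edge takes the weight of its cycle and the
product becomes `m`. Otherwise some edge of `m` lies outside the packing, so its factor vanishes
there, as does `m`. -/
theorem coeff_pullback_edgeMonomial {m : G.DirectedCycle →₀ ℕ}
    (hm : ∀ C ∈ m.support, C.edges.card ≤ m C) {k : G.DirectedCycle →₀ ℕ}
    (hk : G.PairwiseDisjointCycles k.support) :
    coeff k (CProj.pullback G.cycleMap (edgeMonomial m)) = coeff k (monomial m (1 : ℂ)) := by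
  rw [← sub_eq_zero, ← coeff_sub]
  refine forall_aeval_eq_zero_iff_forall_coeff_eq_zero.1 ?_ k Finset.Subset.rfl
  intro y hy
  rw [map_sub, CProj.aeval_pullback, aeval_monomial, map_one, one_mul, sub_eq_zero, edgeMonomial,
    map_prod]
  simp only [map_mul, map_pow, map_prod, aeval_X]
  by_cases hsub : m.support ⊆ k.support
  · refine Finset.prod_congr rfl fun C hC => ?_
    have hval : ∀ e ∈ C.1, G.cycleMap y e = y C := fun e he =>
      cycleMap_apply_of_mem hk hy (hsub hC) he
    rw [hval _ C.exists_mem.choose_spec,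
      Finset.prod_congr rfl fun e he => hval e (DirectedCycle.mem_edges.1 he), Finset.prod_const,
      ← pow_add, Nat.sub_add_cancel (hm C hC)]
  · have h1 : ¬edgeSet m.support ⊆ edgeSet k.support := fun h =>
      hsub (hk.subset_of_edgeSet_subset h)
    obtain ⟨e, ⟨C, hC, heC⟩, he⟩ := Set.not_subset.1 h1
    obtain ⟨D, hD, hDk⟩ := Finset.not_subset.1 hsub
    rw [Finset.prod_eq_zero hC, Finsupp.prod, Finset.prod_eq_zero hD]
    · rw [hy D hDk, zero_pow (Finsupp.mem_support_iff.1 hD)]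
    · rw [Finset.prod_eq_zero (DirectedCycle.mem_edges.2 heC) (cycleMap_apply_of_notMem hy he),
        mul_zero]

theorem single_mem_range_packingCoeff {t : ℕ} [DecidableEq (G.PackingMonomial t)]
    (m : G.PackingMonomial t) (hm : ∀ C ∈ m.1.support, C.edges.card ≤ m.1 C) :
    Pi.single m (1 : ℂ) ∈ LinearMap.range (G.packingCoeff t) := by
  classical
  have hhom : (edgeMonomial m.1).IsHomogeneous t := by
    have h := isHomogeneous_edgeMonomial hm
    rwa [m.2.1] at h
  refine ⟨⟨edgeMonomial m.1, hhom⟩, ?_⟩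
  funext k
  refine (coeff_pullback_edgeMonomial hm k.2.2).trans ?_
  rw [coeff_monomial, Pi.single_apply]
  simp only [Subtype.ext_iff, eq_comm]

/-- The edge monomials have distinct standard basis vectors as coefficient vectors, which bounds the
rank from below. -/
theorem card_le_hilbertFunction {t : ℕ} (ht : t ≠ 0) :
    Nat.card {m : G.PackingMonomial t // ∀ C ∈ m.1.support, C.edges.card ≤ m.1 C} ≤
      CProj.hilbertFunction G.strongIncidenceSet t := by
  classical
  have := Fintype.ofFinite {m : G.PackingMonomial t // ∀ C ∈ m.1.support, C.edges.card ≤ m.1 C}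
  have := Fintype.ofFinite (G.PackingMonomial t)
  rw [hilbertFunction_strongIncidenceSet ht, Nat.card_eq_fintype_card]
  let v : {m : G.PackingMonomial t // ∀ C ∈ m.1.support, C.edges.card ≤ m.1 C} →
      LinearMap.range (G.packingCoeff t) := fun m =>
    ⟨Pi.single m.1 1, single_mem_range_packingCoeff m.1 m.2⟩
  have hv : LinearIndependent ℂ v := by
    refine LinearIndependent.of_comp (LinearMap.range (G.packingCoeff t)).subtype ?_
    have h := (Pi.basisFun ℂ (G.PackingMonomial t)).linearIndependent.comp Subtype.val
      (Subtype.val_injective (p := fun m : G.PackingMonomial t =>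
        ∀ C ∈ m.1.support, C.edges.card ≤ m.1 C))
    convert! h using 1
    funext m
    simp [v, Pi.basisFun_apply]
  exact hv.fintype_card_le_finrank

end DirectedGraph

/-! ### The degree of the incidence set. -/

namespace DirectedGraph

open Filter Topology

variable {V E : Type*} [Fintype E] {G : DirectedGraph V E}

variable (G) in
/-- The packings of maximal cardinality. -/
abbrev MaximumPacking : Type _ := {𝒜 : G.Packing // 𝒜.1.card = G.strongPackingNumber}

theorem card_maximumPacking :
    Nat.card G.MaximumPacking = G.strongSpectrum G.strongPackingNumber := by
  rw [strongSpectrum, ← Nat.card_coe_set_eq]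
  refine Nat.card_congr
    { toFun := fun 𝒜 => ⟨𝒜.1.1, ⟨𝒜.1.2, fun 𝒟 h𝒟 hle => ?_⟩, 𝒜.2⟩
      invFun := fun 𝒞 => ⟨⟨𝒞.1, 𝒞.2.1.prop⟩, 𝒞.2.2⟩
      left_inv := fun _ => rfl
      right_inv := fun _ => rfl }
  have hcard : 𝒟.card ≤ 𝒜.1.1.card := by
    rw [𝒜.2]
    exact Packing.card_le ⟨𝒟, h𝒟⟩
  exact (Finset.eq_of_subset_of_card_le hle hcard).ge

theorem strongSpectrum_strongPackingNumber_ne_zero :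
    G.strongSpectrum G.strongPackingNumber ≠ 0 := by
  rw [← card_maximumPacking]
  obtain ⟨𝒜, h𝒜⟩ := exists_packing_card_eq (G := G)
  have : Nonempty G.MaximumPacking := ⟨⟨𝒜, h𝒜⟩⟩
  exact Nat.card_pos.ne'

/-- Multiplying a monomial on a maximum packing by the `N`-th power of each of its cycles makes
every exponent large enough for an edge monomial. The support becomes the whole packing, so
different packings give different monomials. -/
theorem mul_multichoose_le_hilbertFunction {t : ℕ} (ht : t ≠ 0)
    (hle : G.strongPackingNumber * (Fintype.card E + 1) ≤ t) :
    G.strongSpectrum G.strongPackingNumber *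
      G.strongPackingNumber.multichoose (t - G.strongPackingNumber * (Fintype.card E + 1)) ≤
      CProj.hilbertFunction G.strongIncidenceSet t := by
  classical
  refine le_trans ?_ (card_le_hilbertFunction ht)
  -- No cycle has more than `N` edges, and `N` is positive, so that each cycle of the packing enters
  -- the support.
  set N := Fintype.card E + 1
  set s := t - G.strongPackingNumber * N
  let β : G.MaximumPacking → Type _ := fun 𝒜 =>
    {m : G.DirectedCycle →₀ ℕ | m.degree = s ∧ m.support ⊆ 𝒜.1.1}
  have hβ : ∀ 𝒜, Finite (β 𝒜) := fun 𝒜 =>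
    ((Finsupp.finite_of_degree_eq s).subset fun _ hm => hm.1 :
      {m : G.DirectedCycle →₀ ℕ | m.degree = s ∧ m.support ⊆ 𝒜.1.1}.Finite)
  have hcard : Nat.card (Σ 𝒜, β 𝒜) = G.strongSpectrum G.strongPackingNumber *
      G.strongPackingNumber.multichoose s := by
    have := Fintype.ofFinite G.MaximumPacking
    rw [Nat.card_sigma, ← card_maximumPacking, Nat.card_eq_fintype_card, ← smul_eq_mul,
      ← Finset.card_univ, ← Finset.sum_const]
    refine Finset.sum_congr rfl fun 𝒜 _ => ?_
    rw [Nat.card_coe_set_eq, ncard_degree_eq_support_subset, 𝒜.2]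
  rw [← hcard]
  let shift : G.MaximumPacking → (G.DirectedCycle →₀ ℕ) := fun 𝒜 =>
    ∑ C ∈ 𝒜.1.1, Finsupp.single C N
  have hshift : ∀ 𝒜 C, shift 𝒜 C = if C ∈ 𝒜.1.1 then N else 0 := by
    intro 𝒜 C
    simp only [shift, Finsupp.finsetSum_apply, Finsupp.single_apply]
    rw [Finset.sum_ite_eq']
  have hsupp : ∀ 𝒜 (m : β 𝒜), (m.1 + shift 𝒜).support = 𝒜.1.1 := by
    intro 𝒜 m
    ext C
    rw [Finsupp.mem_support_iff, Finsupp.add_apply, hshift]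
    constructor
    · intro h
      by_contra hC
      rw [if_neg hC, Finsupp.notMem_support_iff.1 fun h => hC (m.2.2 h)] at h
      exact h rfl
    · intro hC
      rw [if_pos hC]
      omega
  have hdeg : ∀ 𝒜 (m : β 𝒜), (m.1 + shift 𝒜).degree = t := by
    intro 𝒜 m
    rw [map_add, m.2.1, map_sum]
    simp only [Finsupp.degree_single, Finset.sum_const, smul_eq_mul, 𝒜.2]
    omega
  refine Nat.card_le_card_of_injective (fun x : Σ 𝒜, β 𝒜 =>
    ⟨⟨x.2.1 + shift x.1, hdeg _ _, by rw [hsupp]; exact x.1.1.2⟩, fun C hC => ?_⟩) ?_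
  · have hC' : C ∈ x.1.1.1 := (hsupp x.1 x.2) ▸ hC
    have h1 : C.edges.card ≤ Fintype.card E := Finset.card_le_univ _
    change C.edges.card ≤ x.2.1 C + shift x.1 C
    rw [hshift, if_pos hC']
    omega
  · rintro ⟨𝒜, m⟩ ⟨ℬ, k⟩ h
    have h1 : m.1 + shift 𝒜 = k.1 + shift ℬ :=
      congrArg (fun z => z.1.1) h
    have h2 : 𝒜 = ℬ := by
      refine Subtype.ext (Subtype.ext ?_)
      rw [← hsupp 𝒜 m, ← hsupp ℬ k, h1]
    subst h2
    rw [Subtype.ext (add_right_cancel h1)]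

theorem tendsto_hilbertFunction_div_pow {r : ℕ} (hr : G.strongPackingNumber = r + 1) :
    Tendsto (fun t : ℕ => (CProj.hilbertFunction G.strongIncidenceSet t : ℚ) / (t : ℚ) ^ r) atTop
      (𝓝 (G.strongSpectrum G.strongPackingNumber * (r.factorial : ℚ)⁻¹)) := by
  classical
  have := Fintype.ofFinite G.Packing
  have hlow := (tendsto_multichoose_sub_div_pow r ((r + 1) * (Fintype.card E + 1))).const_mul
    (G.strongSpectrum G.strongPackingNumber : ℚ)
  have hup : Tendsto (fun t : ℕ => ∑ 𝒜 : G.Packing, (𝒜.1.card.multichoose t : ℚ) / (t : ℚ) ^ r)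
      atTop (𝓝 (∑ 𝒜 : G.Packing,
        if 𝒜.1.card = G.strongPackingNumber then (r.factorial : ℚ)⁻¹ else 0)) := by
    refine tendsto_finsetSum _ fun 𝒜 _ => ?_
    split_ifs with h
    · rw [h, hr]
      exact tendsto_multichoose_sub_div_pow r 0
    · have := 𝒜.card_le
      exact tendsto_multichoose_div_pow_of_le (by omega)
  have hsum : (∑ 𝒜 : G.Packing,
      if 𝒜.1.card = G.strongPackingNumber then (r.factorial : ℚ)⁻¹ else 0) =
      G.strongSpectrum G.strongPackingNumber * (r.factorial : ℚ)⁻¹ := by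
    rw [← card_maximumPacking, Nat.card_eq_fintype_card, Fintype.card_subtype, ← Finset.sum_filter,
      Finset.sum_const, nsmul_eq_mul]
  rw [hsum] at hup
  -- Squeeze: in the upper sum only the maximum packings have a nonzero limit, and the shift of `t`
  -- in the lower bound disappears.
  refine tendsto_of_tendsto_of_tendsto_of_le_of_le' hlow hup ?_ ?_
  · filter_upwards [eventually_ge_atTop ((r + 1) * (Fintype.card E + 1)),
      eventually_ge_atTop 1] with t h1 h2
    rw [← mul_div_assoc]
    have h3 := mul_multichoose_le_hilbertFunction (G := G) (t := t) (by omega) (by rw [hr]; exact h1)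
    rw [hr] at h3 ⊢
    gcongr
    exact_mod_cast h3
  · filter_upwards [eventually_ge_atTop 1] with t h1
    rw [← Finset.sum_div]
    have h2 := hilbertFunction_strongIncidenceSet_le (G := G) (t := t) (by omega)
    rw [finsum_eq_sum_of_fintype] at h2
    gcongr
    exact_mod_cast h2

theorem hasDegree_strongIncidenceSet (h : 1 ≤ G.strongPackingNumber) :
    CProj.HasDegree G.strongIncidenceSet (G.strongSpectrum G.strongPackingNumber) := by
  obtain ⟨r, hr⟩ := Nat.exists_eq_add_of_le' h
  obtain ⟨P, hP⟩ := CProj.exists_eventually_hilbertFunction_eq_eval G.strongIncidenceSet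
  have hfac : (r.factorial : ℚ) ≠ 0 := Nat.cast_ne_zero.2 r.factorial_ne_zero
  have hlim : Tendsto (fun t : ℕ => P.eval (t : ℚ) / (t : ℚ) ^ r) atTop
      (𝓝 (G.strongSpectrum G.strongPackingNumber * (r.factorial : ℚ)⁻¹)) :=
    (tendsto_hilbertFunction_div_pow hr).congr' (hP.mono fun t ht => by rw [ht])
  -- The limit is nonzero because a maximum packing exists; a zero limit would not determine the
  -- degree of `P`.
  obtain ⟨hdeg, hlead⟩ := Polynomial.natDegree_eq_and_leadingCoeff_eq_of_tendsto
    (mul_ne_zero (Nat.cast_ne_zero.2 strongSpectrum_strongPackingNumber_ne_zero)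
      (inv_ne_zero hfac)) hlim
  refine ⟨P, hP, ?_⟩
  rw [hdeg, hlead, mul_comm, mul_assoc, inv_mul_cancel₀ hfac, mul_one]

end DirectedGraph

theorem mainTheorem3 {V E : Type*} [Fintype V] [Fintype E] (G : DirectedGraph V E) :
    (∃ S : Set (Projectivization.Subspace ℂ (E → ℂ)), S.Finite ∧
      G.strongIncidenceSet = ⋃ L ∈ S, (L : Set (CProj E))) ∧
    CProj.HasDim G.strongIncidenceSet ((G.strongPackingNumber : ℤ) - 1) ∧
    (1 ≤ G.strongPackingNumber →
      CProj.HasDegree G.strongIncidenceSet (G.strongSpectrum G.strongPackingNumber)) ∧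
    (∀ n : ℕ, 1 ≤ n →
      {Z ∈ irreducibleComponents G.strongIncidenceSet | CProj.HasDim Z ((n : ℤ) - 1)}.encard =
        (G.strongSpectrum n : ℕ∞)) :=
  ⟨DirectedGraph.exists_subspaces_eq_strongIncidenceSet, DirectedGraph.hasDim_strongIncidenceSet,
    DirectedGraph.hasDegree_strongIncidenceSet, fun _ => DirectedGraph.encard_irreducibleComponents⟩
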